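/- **Setting.** Let $\|\cdot\|$ be the Euclidean norm on $\mathbb R^d$, $d\ge 1$. A *tight frame* is a family $U=(u_1,\dots,u_D)$ in $\mathbb R^d$ with $\|x\|^2=\sum_{j=1}^D\langle u_j,x\rangle^2$ for all $x\in\mathbb R^d$. A *Kashin representation* of $x$ at level $K$ with respect to $U$ is a vector $a\in\mathbb R^D$ with $x=\sum_j a_ju_j$ and $\max_j|a_j|\le \frac{K}{\sqrt D}\|x\|$. **The mechanism.** Let $n,m\ge1$ be integers, $c>0$, $\theta\in[0,\frac14]$, $K>0$, let $U$ be a tight frame of $D$ vectors in $\mathbb R^d$, and let $x\mapsto y(x)\in\mathbb R^D$ assign to each $x$ with $\|x\|\le c$ a Kashin representation of $x$ at level $K$. Put $c'=cK/\sqrt d$ and $M=nm+1$. Client $i$ ($1\le i\le n$) holds $x_i\in\mathbb R^d$ with $\|x_i\|\le c$ and sends $Z_i\in(\mathbb Z/M\mathbb Z)^D$, where all $Z_{ij}\sim\mathrm{Binom}\big(m,\frac12+\frac{\theta}{c'}\,y(x_i)_j\big)$ are independent. Secure aggregation reveals to the server only $S=\sum_iZ_i\in(\mathbb Z/M\mathbb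 Z)^D$. Reading the entries of $S$ in $\{0,\dots,nm\}$, the server outputs $$\hat\mu=\sum_{j=1}^D\frac{c'}{mn\theta}\Big(S_j-\frac{mn}{2}\Big)u_j,$$ an estimate of $\mu=\frac1n\sum_ix_i$. (For $\theta=0$ the factor $\frac{c'}{mn\theta}$ is read as $0$.) The communication cost per client is $\log_2|(\mathbb Z/M\mathbb Z)^D|$ bits. **Privacy.** A mechanism satisfies $(\alpha,\varepsilon)$-RDP if $D_\alpha(P\|Q)=\frac1{\alpha-1}\log\mathbb E_Q\big[(\frac{dP}{dQ})^\alpha\big]\le\varepsilon$ (with $D_\alpha=\infty$ if $P\not\ll Q$) whenever $P,Q$ are the laws of its output on two datasets of $n$ vectors of norm at most $c$ that differ in the vector of at most one client. **Theorem.** (0) There are universal constants $K,\Gamma>0$ such that for every $d\ge1$ there is a tight frame of $D$ vectors in $\mathbb R^d$, $d\le D\le\Gamma d$, with respect to which every $x\in\mathbb R^d$ has a Kashin representation at level $K$. For all $K,\Gamma>0$ there is a constant $C>0$, depending only on $K$ and $\Gamma$ (hence universal for the frames in (0)), such that for all $d,n,m\ge1$, $c>0$, $\theta\in[0,\frac14]$,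 all tight frames of $D\le\Gamma d$ vectors in $\mathbb R^d$ and all maps $y$ as above, the multi-dimensional Poisson binomial mechanism has the following properties. 1. For every $\alpha>1$ and every $\varepsilon\ge C\,\frac{dm\theta^2\alpha}{n}$, both the sum $S$ that the server receives and the output $\hat\mu$ satisfy $(\alpha,\varepsilon)$-RDP. 2. The communication cost per client is at most $C\,d(\log_2m+\log_2n+1)$ bits, and at most $C\,d(\log_2m+\log_2n)$ bits if $nm\ge2$. 3. If $\theta>0$, then for all $x_1,\dots,x_n$ of norm at most $c$, $\mathbb E[\hat\mu]=\mu$ and $\mathbb E\|\hat\mu-\mu\|^2\le C\,\frac{c^2}{nm\theta^2}$. -/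

import Mathlib

open MeasureTheory ProbabilityTheory

noncomputable section

namespace PBM

/-- The Rényi divergence of order `α > 1` of `P` from `Q`,
`(α - 1)⁻¹ log E_Q[(dP/dQ)^α]`, which is `∞` if `P` is not absolutely continuous w.r.t. `Q`. -/
def renyiDiv {Ω : Type*} [MeasurableSpace Ω] (α : ℝ) (P Q : Measure Ω) : EReal :=
  open Classical in
  if P ≪ Q then ((α - 1)⁻¹ : ℝ) * ENNReal.log (∫⁻ ω, (P.rnDeriv Q ω) ^ α ∂Q) else ⊤

/-- Two datasets of `n` clients are neighboring if they differ in the data of at most one client. -/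
def Neighboring {n : ℕ} {X : Type*} (x x' : Fin n → X) : Prop :=
  ∃ i, ∀ k, k ≠ i → x k = x' k

/-- `(α, ε)`-Rényi differential privacy of a randomized mechanism on datasets of `n` clients whose
data lie in `B`; the mechanism is given by the law of its output. -/
def IsRDP {n : ℕ} {X Ω : Type*} [MeasurableSpace Ω] (B : Set X)
    (mech : (Fin n → X) → Measure Ω) (α ε : ℝ) : Prop :=
  ∀ x x' : Fin n → X, (∀ i, x i ∈ B) → (∀ i, x' i ∈ B) → Neighboring x x' →
    renyiDiv α (mech x) (mech x') ≤ (ε : EReal)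

/-- A tight frame: a family of vectors satisfying Parseval's identity. -/
def IsTightFrame {d D : ℕ} (u : Fin D → EuclideanSpace ℝ (Fin d)) : Prop :=
  ∀ x : EuclideanSpace ℝ (Fin d), ‖x‖ ^ 2 = ∑ j, (inner ℝ (u j) x) ^ 2

/-- `a` is the coefficient vector of a Kashin representation of `x` at level `K`. -/
def IsKashinRep {d D : ℕ} (u : Fin D → EuclideanSpace ℝ (Fin d)) (K : ℝ)
    (x : EuclideanSpace ℝ (Fin d)) (a : Fin D → ℝ) : Prop :=
  x = ∑ j, a j • u j ∧ ∀ j, |a j| ≤ K / √D * ‖x‖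

/-- The law `Binom(m, p)`, `p = (θ / c) x + 1 / 2`, of the scalar mechanism. The projection onto
`[0, 1]` only makes the definition total: see `projIcc_scalar`. -/
def scalarPBM (c : ℝ) (m : ℕ) (θ x : ℝ) : Measure ℕ :=
  binomial m (Set.projIcc (0 : ℝ) 1 zero_le_one (θ / c * x + 1 / 2))

theorem projIcc_scalar {c θ x : ℝ} (hc : 0 < c) (hθ : θ ∈ Set.Icc (0 : ℝ) (1 / 4))
    (hx : |x| ≤ c) :
    (Set.projIcc (0 : ℝ) 1 zero_le_one (θ / c * x + 1 / 2) : ℝ) = θ / c * x + 1 / 2 := by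
  have h : |θ / c * x| ≤ 1 / 4 := by
    have h1 : |x| / c ≤ 1 := (div_le_one hc).2 hx
    have h0 : 0 ≤ |x| / c := by positivity
    have h2 : |θ / c * x| = θ * (|x| / c) := by
      rw [abs_mul, abs_of_nonneg (div_nonneg hθ.1 hc.le)]; ring
    rw [h2]
    nlinarith [hθ.1, hθ.2]
  rw [abs_le] at h
  rw [Set.projIcc_of_mem zero_le_one (x := θ / c * x + 1 / 2) ⟨by linarith, by linarith⟩]

/-- The group `(ℤ/Mℤ)^D` over which secure aggregation takes place. The sum of `n` messages with
entries in `{0, …, m}` ranges over `{0, …, n m}`, so `M = n m + 1` is the smallest modulus without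
overflow. -/
abbrev SecAggGroup (n m D : ℕ) : Type := Fin D → ZMod (n * m + 1)

/-- The number of bits that one client sends: the binary logarithm of the size of the group. -/
def clientBits (n m D : ℕ) : ℝ := Real.logb 2 (Nat.card (SecAggGroup n m D))

/-- The range bound `c' = c K / √d` for the coefficients. -/
def coeffBound (d : ℕ) (c K : ℝ) : ℝ := c * K / √d

/-- The law of the message of a client with coefficient vector `y`: independent scalar mechanisms
in the coordinates, reduced modulo `M`. -/
def encode (n m D : ℕ) (c' θ : ℝ) (y : Fin D → ℝ) : Measure (SecAggGroup n m D) :=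
  (Measure.pi fun j => scalarPBM c' m θ (y j)).map fun z j => (z j : ZMod (n * m + 1))

/-- The law of what the server receives, the sum of the independent messages of the clients. Here
`rep` computes the coefficient vector of a client's data. -/
def aggregate {d D : ℕ} (n m : ℕ) (c K θ : ℝ) (rep : EuclideanSpace ℝ (Fin d) → Fin D → ℝ)
    (x : Fin n → EuclideanSpace ℝ (Fin d)) : Measure (SecAggGroup n m D) :=
  (Measure.pi fun i => encode n m D (coeffBound d c K) θ (rep (x i))).map fun z => ∑ i, z i

/-- The server's estimate, computed from the sum `s` that it receives. -/
def decode {d D : ℕ} (n m : ℕ) (c K θ : ℝ) (u : Fin D → EuclideanSpace ℝ (Fin d))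
    (s : SecAggGroup n m D) : EuclideanSpace ℝ (Fin d) :=
  ∑ j, (coeffBound d c K / (m * n * θ) * (((s j).val : ℝ) - m * n / 2)) • u j

/-- The law of the output of the multi-dimensional Poisson binomial mechanism. -/
def pbm {d D : ℕ} (n m : ℕ) (c K θ : ℝ) (u : Fin D → EuclideanSpace ℝ (Fin d))
    (rep : EuclideanSpace ℝ (Fin d) → Fin D → ℝ)
    (x : Fin n → EuclideanSpace ℝ (Fin d)) : Measure (EuclideanSpace ℝ (Fin d)) :=
  (aggregate n m c K θ rep x).map (decode n m c K θ u)

/-- The mean of the clients' data. -/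
def mean {d n : ℕ} (x : Fin n → EuclideanSpace ℝ (Fin d)) : EuclideanSpace ℝ (Fin d) :=
  (n : ℝ)⁻¹ • ∑ i, x i

end PBM

end

open MeasureTheory ProbabilityTheory

noncomputable section

namespace PBM

open scoped ENNReal

/-! Privacy. In the convolution algebra `Law`, a binomial is a power of a coin, so the law of the
sum factors into `D * m` groups, each with one coin per client. Rényi bounds add up under
convolution and survive pushforward, so it suffices to change one parameter among `n` coins, at a
cost of order `α θ² / n`. All parameters lie in `[1/4, 3/4]`, so each unchanged coin is a mixture of
a `1/4`-coin and a `3/4`-coin. By joint convexity only `a` coins of the first kind and `b` of the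
second remain, and the smaller group may be dropped. What is left is one coin next to `N` equal
coins, where the likelihood ratio `ρ` is a quotient of two affine functions of the number of heads
(`tilt`) with increments of order `θ / N`. Then `E_Q ρ^α = E_P ρ^(α-1) ≤ E_P exp((α-1)(ρ-1))`, and
McDiarmid's bound `coinExp_exp_le` finishes. Rényi bounds are carried in the dual form `HolderDom`,
which makes these stability properties short.

Accuracy. The modulus prevents wrap-around, so each coordinate of the sum counts heads among `n * m`
coins: its mean is affine in the coefficients and its variance is at most `n * m / 4`. Synthesis by
a tight frame is a contraction, so the errors of the coordinates add up. The Kashin bound keeps `D *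
c'²` of order `c²`. The communication cost is a direct count.

Frames. A random `D × d` sign matrix with `D = 200 * d` has, with positive probability, operator
norm at most `12 √D` and `ℓ¹` norm at least `D / 16` on the image of every unit vector. Both follow
from exponential moments and union bounds over nets. The coordinate functionals of its range form a
tight frame, and Hahn–Banach separation turns the comparison of norms into Kashin representations.
-/

/-- Finitely supported measures on `G` as elements of the monoid algebra, where multiplication is
convolution. -/
abbrev Law (G : Type*) : Type _ := AddMonoidAlgebra ℝ≥0∞ G

/-! ### The convolution algebra of finitely supported measures -/

namespace Law

section Basic

variable {G : Type*} [MeasurableSpace G]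

/-- The measure defined by an element of the monoid algebra. -/
def toMeasure : Law G →+ Measure G :=
  (Finsupp.liftAddHom fun s : G =>
    { toFun := fun r : ℝ≥0∞ => r • Measure.dirac s
      map_zero' := zero_smul _ _
      map_add' := fun r r' => add_smul r r' _ }).comp AddMonoidAlgebra.coeffAddEquiv.toAddMonoidHom

@[simp]
theorem toMeasure_single (s : G) (r : ℝ≥0∞) :
    toMeasure (AddMonoidAlgebra.single s r : Law G) = r • Measure.dirac s := by
  simp [toMeasure]

instance sFinite_toMeasure (a : Law G) : SFinite (toMeasure a) := by
  induction a using AddMonoidAlgebra.induction_linear with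
  | zero => rw [map_zero]; infer_instance
  | add a b ha hb => rw [map_add]; infer_instance
  | single s r => rw [toMeasure_single]; infer_instance

end Basic

section Conv

variable {G : Type*} [AddCommMonoid G] [MeasurableSpace G]

@[simp]
theorem toMeasure_one : toMeasure (1 : Law G) = Measure.dirac 0 := by
  rw [AddMonoidAlgebra.one_def, toMeasure_single, one_smul]

variable [MeasurableAdd₂ G]

theorem toMeasure_mul (a b : Law G) : toMeasure (a * b) = (toMeasure a).conv (toMeasure b) := by
  induction a using AddMonoidAlgebra.induction_linear with
  | zero => simp
  | add a a' ha ha' => rw [add_mul, map_add, map_add, ha, ha', Measure.add_conv]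
  | single s r =>
    induction b using AddMonoidAlgebra.induction_linear with
    | zero => simp
    | add b b' hb hb' => rw [mul_add, map_add, map_add, hb, hb', Measure.conv_add]
    | single t r' =>
      rw [AddMonoidAlgebra.single_mul_single, toMeasure_single, toMeasure_single, toMeasure_single,
        Measure.conv_smul_left, Measure.conv_smul_right, Measure.dirac_conv_dirac, smul_smul]

/-- If `μ i` is carried by `f i` to the law `a i`, then the product of the `μ i` is carried by
`z ↦ ∑ i, f i (z i)` to the convolution of the `a i`. -/
theorem map_sum_pi {ι : Type*} [Fintype ι] {X : ι → Type*} [∀ i, MeasurableSpace (X i)]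
    (μ : ∀ i, Measure (X i)) [∀ i, IsProbabilityMeasure (μ i)] (f : ∀ i, X i → G)
    (hf : ∀ i, Measurable (f i)) (a : ι → Law G) (h : ∀ i, (μ i).map (f i) = toMeasure (a i)) :
    (Measure.pi μ).map (fun z => ∑ i, f i (z i)) = toMeasure (∏ i, a i) := by
  classical
  have hi := iIndepFun_pi (μ := μ) (X := f) fun i => (hf i).aemeasurable
  have hm : ∀ i, Measurable fun z : ∀ i, X i => f i (z i) := fun i =>
    (hf i).comp (measurable_pi_apply i)
  have hms : ∀ s : Finset ι, Measurable (∑ i ∈ s, fun z : ∀ i, X i => f i (z i)) := by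
    intro s
    convert Finset.measurable_sum s fun j _ => hm j using 1
    ext z
    simp
  have key : ∀ s : Finset ι,
      (Measure.pi μ).map (∑ i ∈ s, fun z : ∀ i, X i => f i (z i)) = toMeasure (∏ i ∈ s, a i) := by
    intro s
    induction s using Finset.induction_on with
    | empty =>
      rw [Finset.sum_empty, Finset.prod_empty, toMeasure_one]
      change Measure.map (fun _ => (0 : G)) _ = _
      rw [Measure.map_const, measure_univ, one_smul]
    | insert i s his ih =>
      have hind := hi.indepFun_finsetSum_of_notMem hm his
      rw [Finset.sum_insert his, Finset.prod_insert his, toMeasure_mul, ← h i, ← ih,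
        hind.symm.map_add_eq_map_conv_map (hm i) (hms s)]
      congr 1
      change Measure.map (f i ∘ Function.eval i) _ = _
      rw [← Measure.map_map (hf i) (measurable_pi_apply i),
        (measurePreserving_eval μ i).map_eq]
  rw [← key Finset.univ]
  congr 1
  ext z
  simp

end Conv

section Map

variable {G H : Type*} [AddCommMonoid G] [AddCommMonoid H] [MeasurableSpace G] [MeasurableSpace H]

/-- The image of a law under an additive homomorphism. -/
abbrev map (φ : G →+ H) : Law G →+* Law H := AddMonoidAlgebra.mapDomainRingHom ℝ≥0∞ φ

theorem toMeasure_map (φ : G →+ H) (hφ : Measurable φ) (a : Law G) :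
    toMeasure (map φ a) = (toMeasure a).map φ := by
  induction a using AddMonoidAlgebra.induction_linear with
  | zero => simp
  | add a b ha hb => rw [map_add, map_add, map_add, Measure.map_add _ _ hφ, ha, hb]
  | single s r => simp [Measure.map_smul, Measure.map_dirac' hφ]

end Map

section Coin

variable {G : Type*} [AddCommMonoid G]

/-- The law of `v` times a Bernoulli variable of parameter `p`. -/
def coin (v : G) (p : ℝ) : Law G :=
  AddMonoidAlgebra.single 0 (ENNReal.ofReal (1 - p)) + AddMonoidAlgebra.single v (ENNReal.ofReal p)

theorem map_coin {H : Type*} [AddCommMonoid H] (φ : G →+ H) (v : G) (p : ℝ) :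
    map φ (coin v p) = coin (φ v) p := by
  rw [coin, coin, map_add, AddMonoidAlgebra.mapDomainRingHom_apply,
    AddMonoidAlgebra.mapDomainRingHom_apply, AddMonoidAlgebra.mapDomain_single,
    AddMonoidAlgebra.mapDomain_single, map_zero]

theorem coin_zero {p : ℝ} (hp : p ∈ Set.Icc (0 : ℝ) 1) : coin (0 : G) p = 1 := by
  rw [coin, ← AddMonoidAlgebra.single_add, ← ENNReal.ofReal_add (by linarith [hp.2]) hp.1,
    sub_add_cancel, ENNReal.ofReal_one, AddMonoidAlgebra.one_def]

/-- A coin whose parameter is a convex combination is a mixture of coins. -/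
theorem coin_mix (v : G) {p q w : ℝ} (hp : p ∈ Set.Icc (0 : ℝ) 1) (hq : q ∈ Set.Icc (0 : ℝ) 1)
    (hw : w ∈ Set.Icc (0 : ℝ) 1) :
    coin v ((1 - w) * p + w * q) =
      ENNReal.ofReal (1 - w) • coin v p + ENNReal.ofReal w • coin v q := by
  have h1 : (0 : ℝ) ≤ 1 - w := by linarith [hw.2]
  have hp1 : (0 : ℝ) ≤ 1 - p := by linarith [hp.2]
  have hq1 : (0 : ℝ) ≤ 1 - q := by linarith [hq.2]
  have e : 1 - ((1 - w) * p + w * q) = (1 - w) * (1 - p) + w * (1 - q) := by ring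
  rw [coin, coin, coin, e, ENNReal.ofReal_add (mul_nonneg h1 hp1) (mul_nonneg hw.1 hq1),
    ENNReal.ofReal_add (mul_nonneg h1 hp.1) (mul_nonneg hw.1 hq.1), ENNReal.ofReal_mul h1,
    ENNReal.ofReal_mul h1, ENNReal.ofReal_mul hw.1, ENNReal.ofReal_mul hw.1,
    AddMonoidAlgebra.single_add, AddMonoidAlgebra.single_add]
  simp only [smul_add, AddMonoidAlgebra.smul_single, smul_eq_mul]
  abel

variable [MeasurableSpace G]

theorem toMeasure_smul (r : ℝ≥0∞) (a : Law G) : toMeasure (r • a) = r • toMeasure a := by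
  induction a using AddMonoidAlgebra.induction_linear with
  | zero => simp
  | add a b ha hb => rw [smul_add, map_add, map_add, smul_add, ha, hb]
  | single s r' => simp [smul_smul]

/-- This is the binomial theorem in the convolution algebra: expanding the power of a two-term
element reproduces the binomial weights. -/
theorem map_binomial (v : G) (m : ℕ) (p : unitInterval) :
    (binomial m p).map (fun k => k • v) = toMeasure (coin v p ^ m) := by
  have h1 : (0 : ℝ) ≤ 1 - p := by linarith [p.2.2]
  rw [binomial_eq_sum_dirac, Measure.map_finset_sum (Measurable.of_discrete).aemeasurable,
    coin, add_comm, add_pow, map_sum]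
  rw [← Nat.range_succ_eq_Iic]
  refine Finset.sum_congr rfl fun k _ => ?_
  rw [Measure.map_smul, Measure.map_dirac' Measurable.of_discrete, AddMonoidAlgebra.single_pow,
    AddMonoidAlgebra.single_pow, AddMonoidAlgebra.single_mul_single, ← nsmul_eq_mul',
    AddMonoidAlgebra.smul_single,
    toMeasure_single, smul_zero, add_zero]
  congr 1
  rw [← ENNReal.ofReal_pow p.2.1, ← ENNReal.ofReal_pow h1,
    ← ENNReal.ofReal_mul (pow_nonneg p.2.1 _), nsmul_eq_mul, mul_assoc,
    ENNReal.ofReal_mul (by positivity), ENNReal.ofReal_natCast]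

end Coin

end Law

/-! ### Rényi bounds in dual form -/

/-- The dual form of the bound `ε` on the Rényi divergence of order `α` of `μ` from `ν`: the Hölder
inequality that the density of `μ` satisfies. Unlike the divergence it makes no reference to a
density. -/
def HolderDom {Ω : Type*} [MeasurableSpace Ω] (α ε : ℝ) (μ ν : Measure Ω) : Prop :=
  ∀ g : Ω → ℝ≥0∞, Measurable g →
    ∫⁻ ω, g ω ∂μ ≤
      ENNReal.ofReal (Real.exp ((α - 1) / α * ε)) *
        (∫⁻ ω, g ω ^ (α / (α - 1)) ∂ν) ^ ((α - 1) / α)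

namespace HolderDom

variable {Ω Ω' : Type*} [MeasurableSpace Ω] [MeasurableSpace Ω'] {α ε ε₁ ε₂ : ℝ}

theorem mono (hα : 1 < α) (hε : ε₁ ≤ ε₂) {μ ν : Measure Ω} (h : HolderDom α ε₁ μ ν) :
    HolderDom α ε₂ μ ν := by
  intro g hg
  refine (h g hg).trans ?_
  have : 0 ≤ (α - 1) / α := div_nonneg (by linarith) (by linarith)
  gcongr

theorem map {μ ν : Measure Ω} (h : HolderDom α ε μ ν) {f : Ω → Ω'} (hf : Measurable f) :
    HolderDom α ε (μ.map f) (ν.map f) := by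
  intro g hg
  rw [lintegral_map hg hf, lintegral_map (by fun_prop) hf]
  exact h _ (hg.comp hf)

theorem of_density (hα : 1 < α) {ν : Measure Ω} {ρ : Ω → ℝ≥0∞} (hρ : Measurable ρ)
    (h : ∫⁻ ω, ρ ω ^ α ∂ν ≤ ENNReal.ofReal (Real.exp ((α - 1) * ε))) :
    HolderDom α ε (ν.withDensity ρ) ν := by
  intro g hg
  have hconj : α.HolderConjugate (α / (α - 1)) := Real.HolderConjugate.conjExponent hα
  rw [lintegral_withDensity_eq_lintegral_mul _ hρ hg]
  refine (ENNReal.lintegral_mul_le_Lp_mul_Lq ν hconj hρ.aemeasurable hg.aemeasurable).trans ?_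
  rw [one_div_div]
  gcongr
  have h0 : 0 < α := by linarith
  calc (∫⁻ ω, ρ ω ^ α ∂ν) ^ (1 / α)
      ≤ ENNReal.ofReal (Real.exp ((α - 1) * ε)) ^ (1 / α) := by gcongr
    _ = ENNReal.ofReal (Real.exp ((α - 1) / α * ε)) := by
        rw [ENNReal.ofReal_rpow_of_pos (Real.exp_pos _), ← Real.exp_mul]
        congr 2
        field_simp

theorem refl (hα : 1 < α) (μ : Measure Ω) [IsProbabilityMeasure μ] : HolderDom α 0 μ μ := by
  have h := of_density (ε := 0) (ν := μ) (ρ := fun _ => 1) hα measurable_const (by simp)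
  rwa [show (fun _ : Ω => (1 : ℝ≥0∞)) = 1 from rfl, withDensity_one] at h

/-- The second bound is applied to each translate of the test function. The inner `L^β(ν₂)` norm,
with `β = α / (α - 1)`, is then itself a test function for the first bound; since the exponents
match, the iterated norm collapses. -/
theorem conv {G : Type*} [AddCommMonoid G] [MeasurableSpace G] [MeasurableAdd₂ G] (hα : 1 < α)
    {μ₁ μ₂ ν₁ ν₂ : Measure G} [SFinite μ₂] [SFinite ν₂] (h₁ : HolderDom α ε₁ μ₁ ν₁)
    (h₂ : HolderDom α ε₂ μ₂ ν₂) :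
    HolderDom α (ε₁ + ε₂) (μ₁.conv μ₂) (ν₁.conv ν₂) := by
  intro g hg
  have h0 : 0 < α := by linarith
  have h1 : 0 < α - 1 := by linarith
  rw [Measure.lintegral_conv hg, Measure.lintegral_conv (by fun_prop)]
  have hm : Measurable fun x => ∫⁻ y, g (x + y) ^ (α / (α - 1)) ∂ν₂ := by
    have : Measurable fun z : G × G => g (z.1 + z.2) ^ (α / (α - 1)) := by fun_prop
    exact this.lintegral_prod_right'
  calc ∫⁻ x, ∫⁻ y, g (x + y) ∂μ₂ ∂μ₁
      ≤ ∫⁻ x, ENNReal.ofReal (Real.exp ((α - 1) / α * ε₂)) *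
          (∫⁻ y, g (x + y) ^ (α / (α - 1)) ∂ν₂) ^ ((α - 1) / α) ∂μ₁ :=
        lintegral_mono fun x => h₂ _ (by fun_prop)
    _ = ENNReal.ofReal (Real.exp ((α - 1) / α * ε₂)) *
          ∫⁻ x, (∫⁻ y, g (x + y) ^ (α / (α - 1)) ∂ν₂) ^ ((α - 1) / α) ∂μ₁ :=
        lintegral_const_mul _ (hm.pow_const _)
    _ ≤ ENNReal.ofReal (Real.exp ((α - 1) / α * ε₂)) *
          (ENNReal.ofReal (Real.exp ((α - 1) / α * ε₁)) *
            (∫⁻ x, ((∫⁻ y, g (x + y) ^ (α / (α - 1)) ∂ν₂) ^ ((α - 1) / α)) ^ (α / (α - 1))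
              ∂ν₁) ^ ((α - 1) / α)) := by
        gcongr
        exact h₁ _ (hm.pow_const _)
    _ = _ := by
        have e : (α - 1) / α * (α / (α - 1)) = 1 := by field_simp
        simp_rw [← ENNReal.rpow_mul, e, ENNReal.rpow_one]
        rw [← mul_assoc, ← ENNReal.ofReal_mul (Real.exp_pos _).le, ← Real.exp_add]
        congr 4
        ring

/-- Joint convexity: in dual form it reduces to the concavity of `t ↦ t ^ ((α - 1) / α)`. -/
theorem mix (hα : 1 < α) {w₁ w₂ : ℝ≥0∞} (hw : w₁ + w₂ = 1) {μ₁ μ₂ ν₁ ν₂ : Measure Ω}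
    (h₁ : HolderDom α ε μ₁ ν₁) (h₂ : HolderDom α ε μ₂ ν₂) :
    HolderDom α ε (w₁ • μ₁ + w₂ • μ₂) (w₁ • ν₁ + w₂ • ν₂) := by
  intro g hg
  have h0 : 0 < α := by linarith
  have h1 : 0 < α - 1 := by linarith
  have e : (α - 1) / α * (α / (α - 1)) = 1 := by field_simp
  simp only [lintegral_add_measure, lintegral_smul_measure, smul_eq_mul]
  set c := ENNReal.ofReal (Real.exp ((α - 1) / α * ε))
  set A := ∫⁻ ω, g ω ^ (α / (α - 1)) ∂ν₁
  set B := ∫⁻ ω, g ω ^ (α / (α - 1)) ∂ν₂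
  calc w₁ * ∫⁻ ω, g ω ∂μ₁ + w₂ * ∫⁻ ω, g ω ∂μ₂
      ≤ w₁ * (c * A ^ ((α - 1) / α)) + w₂ * (c * B ^ ((α - 1) / α)) := by
        gcongr
        · exact h₁ g hg
        · exact h₂ g hg
    _ = c * (w₁ * A ^ ((α - 1) / α) + w₂ * B ^ ((α - 1) / α)) := by ring
    _ ≤ c * (w₁ * A + w₂ * B) ^ ((α - 1) / α) := by
        gcongr
        have hp : 1 ≤ α / (α - 1) := by rw [le_div_iff₀ h1]; linarith
        have := ENNReal.rpow_arith_mean_le_arith_mean2_rpow w₁ w₂ (A ^ ((α - 1) / α))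
          (B ^ ((α - 1) / α)) hw hp
        rw [← ENNReal.rpow_mul, ← ENNReal.rpow_mul, e, ENNReal.rpow_one, ENNReal.rpow_one] at this
        calc _ = ((w₁ * A ^ ((α - 1) / α) + w₂ * B ^ ((α - 1) / α)) ^ (α / (α - 1))) ^
                ((α - 1) / α) := by
              rw [← ENNReal.rpow_mul, mul_comm (α / (α - 1)), e, ENNReal.rpow_one]
          _ ≤ _ := by gcongr

theorem absolutelyContinuous (hα : 1 < α) {μ ν : Measure Ω} (h : HolderDom α ε μ ν) : μ ≪ ν := by
  have h1 : 0 < α - 1 := by linarith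
  have hb : 0 < α / (α - 1) := by positivity
  have hb' : 0 < (α - 1) / α := by positivity
  refine Measure.AbsolutelyContinuous.mk fun s hs hs0 => ?_
  have := h (s.indicator 1) (measurable_one.indicator hs)
  have e : (fun ω => s.indicator (1 : Ω → ℝ≥0∞) ω ^ (α / (α - 1))) = s.indicator 1 := by
    ext ω
    by_cases hω : ω ∈ s <;> simp [hω, hb]
  rw [e, lintegral_indicator_one hs, lintegral_indicator_one hs, hs0, ENNReal.zero_rpow_of_pos hb',
    mul_zero] at this
  exact le_antisymm this zero_le

/-- Testing with the power `α - 1` of the density gives `I ≤ C * I ^ ((α - 1) / α)` for the integral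
`I`, hence `I ≤ C ^ α`. Cancelling a power of `I` needs `I` finite, so the density is first
truncated at `k`; Fatou's lemma removes the truncation. -/
theorem lintegral_rnDeriv_rpow_le (hα : 1 < α) {μ ν : Measure Ω} [IsFiniteMeasure μ]
    [IsFiniteMeasure ν] (h : HolderDom α ε μ ν) :
    ∫⁻ ω, μ.rnDeriv ν ω ^ α ∂ν ≤ ENNReal.ofReal (Real.exp ((α - 1) * ε)) := by
  have h0 : 0 < α := by linarith
  have h1 : 0 < α - 1 := by linarith
  have hr : Measurable (μ.rnDeriv ν) := Measure.measurable_rnDeriv μ ν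
  have key : ∀ k : ℕ, ∫⁻ ω, min (μ.rnDeriv ν ω) k ^ α ∂ν ≤
      ENNReal.ofReal (Real.exp ((α - 1) * ε)) := by
    intro k
    have hmk : Measurable fun ω => min (μ.rnDeriv ν ω) (k : ℝ≥0∞) := hr.min measurable_const
    set I := ∫⁻ ω, min (μ.rnDeriv ν ω) k ^ α ∂ν with hI
    have hfin : I ≠ ∞ := by
      refine ne_top_of_le_ne_top (b := ∫⁻ _, (k : ℝ≥0∞) ^ α ∂ν) ?_
        (lintegral_mono fun ω => by gcongr; exact min_le_right _ _)
      rw [lintegral_const]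
      exact ENNReal.mul_ne_top (ENNReal.rpow_ne_top_of_nonneg h0.le (by simp)) (measure_ne_top _ _)
    have hle : I ≤ ENNReal.ofReal (Real.exp ((α - 1) / α * ε)) * I ^ ((α - 1) / α) := by
      calc I ≤ ∫⁻ ω, μ.rnDeriv ν ω * min (μ.rnDeriv ν ω) k ^ (α - 1) ∂ν := by
            refine lintegral_mono fun ω => ?_
            calc min (μ.rnDeriv ν ω) k ^ α
                = min (μ.rnDeriv ν ω) k * min (μ.rnDeriv ν ω) k ^ (α - 1) := by
                  conv_lhs => rw [show α = 1 + (α - 1) by ring,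
                    ENNReal.rpow_add_of_nonneg _ _ zero_le_one h1.le, ENNReal.rpow_one]
              _ ≤ _ := by gcongr; exact min_le_left _ _
        _ = ∫⁻ ω, min (μ.rnDeriv ν ω) k ^ (α - 1) ∂μ :=
            lintegral_rnDeriv_mul (h.absolutelyContinuous hα) (hmk.pow_const _).aemeasurable
        _ ≤ _ := h _ (hmk.pow_const _)
        _ = _ := by
            have e : (α - 1) * (α / (α - 1)) = α := by field_simp
            simp_rw [← ENNReal.rpow_mul, e, hI]
    rcases eq_or_ne I 0 with hz | hz
    · rw [hz]; exact zero_le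
    have hq0 : I ^ ((α - 1) / α) ≠ 0 := by
      simp [hz, hfin]
    have hqt : I ^ ((α - 1) / α) ≠ ∞ := ENNReal.rpow_ne_top_of_nonneg (by positivity) hfin
    have hsplit : I = I ^ (1 / α) * I ^ ((α - 1) / α) := by
      rw [← ENNReal.rpow_add _ _ hz hfin, show 1 / α + (α - 1) / α = 1 by field_simp; ring,
        ENNReal.rpow_one]
    have h2 : I ^ (1 / α) ≤ ENNReal.ofReal (Real.exp ((α - 1) / α * ε)) := by
      exact (ENNReal.mul_le_mul_iff_left hq0 hqt).1 (hsplit.symm.trans_le hle)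
    calc I = (I ^ (1 / α)) ^ α := by
          rw [← ENNReal.rpow_mul, one_div_mul_cancel h0.ne', ENNReal.rpow_one]
      _ ≤ ENNReal.ofReal (Real.exp ((α - 1) / α * ε)) ^ α := by gcongr
      _ = _ := by
          rw [ENNReal.ofReal_rpow_of_pos (Real.exp_pos _), ← Real.exp_mul]
          congr 2
          field_simp
  have hlim : ∀ ω, Filter.Tendsto (fun k : ℕ => min (μ.rnDeriv ν ω) (k : ℝ≥0∞) ^ α)
      Filter.atTop (nhds (μ.rnDeriv ν ω ^ α)) := by
    intro ω
    have h3 : Filter.Tendsto (fun k : ℕ => min (μ.rnDeriv ν ω) (k : ℝ≥0∞)) Filter.atTop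
        (nhds (μ.rnDeriv ν ω)) := by
      simpa using (tendsto_const_nhds (x := μ.rnDeriv ν ω)).min ENNReal.tendsto_nat_nhds_top
    exact (ENNReal.continuous_rpow_const.tendsto _).comp h3
  calc ∫⁻ ω, μ.rnDeriv ν ω ^ α ∂ν
      = ∫⁻ ω, Filter.liminf (fun k : ℕ => min (μ.rnDeriv ν ω) (k : ℝ≥0∞) ^ α) Filter.atTop ∂ν := by
        simp_rw [fun ω => (hlim ω).liminf_eq]
    _ ≤ Filter.liminf (fun k : ℕ => ∫⁻ ω, min (μ.rnDeriv ν ω) (k : ℝ≥0∞) ^ α ∂ν) Filter.atTop :=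
        lintegral_liminf_le fun k => (hr.min measurable_const).pow_const _
    _ ≤ Filter.liminf (fun _ : ℕ => ENNReal.ofReal (Real.exp ((α - 1) * ε))) Filter.atTop :=
        Filter.liminf_le_liminf (Filter.Eventually.of_forall key)
    _ = _ := by simp

theorem renyiDiv_le (hα : 1 < α) {μ ν : Measure Ω} [IsFiniteMeasure μ] [IsFiniteMeasure ν]
    (h : HolderDom α ε μ ν) : renyiDiv α μ ν ≤ (ε : EReal) := by
  have h1 : 0 < α - 1 := by linarith
  rw [renyiDiv, if_pos (h.absolutelyContinuous hα)]
  have hlog : ENNReal.log (∫⁻ ω, μ.rnDeriv ν ω ^ α ∂ν) ≤ (((α - 1) * ε : ℝ) : EReal) := by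
    calc _ ≤ ENNReal.log (ENNReal.ofReal (Real.exp ((α - 1) * ε))) :=
          ENNReal.log_monotone (h.lintegral_rnDeriv_rpow_le hα)
      _ = _ := by
          rw [ENNReal.log_ofReal, if_neg (not_le.2 (Real.exp_pos _)), Real.log_exp]
  calc _ ≤ (((α - 1)⁻¹ : ℝ) : EReal) * (((α - 1) * ε : ℝ) : EReal) := by
        gcongr
    _ = (ε : EReal) := by
        rw [← EReal.coe_mul, inv_mul_cancel_left₀ h1.ne']

end HolderDom

namespace Law

variable {G : Type*} [AddCommMonoid G] [MeasurableSpace G] [MeasurableAdd₂ G] {α ε ε₁ ε₂ : ℝ}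

theorem holderDom_mul (hα : 1 < α) {a₁ a₂ b₁ b₂ : Law G}
    (h₁ : HolderDom α ε₁ (toMeasure a₁) (toMeasure b₁))
    (h₂ : HolderDom α ε₂ (toMeasure a₂) (toMeasure b₂)) :
    HolderDom α (ε₁ + ε₂) (toMeasure (a₁ * a₂)) (toMeasure (b₁ * b₂)) := by
  rw [toMeasure_mul, toMeasure_mul]
  exact h₁.conv hα h₂

theorem holderDom_prod (hα : 1 < α) {ι : Type*} (s : Finset ι) {a b : ι → Law G}
    (h : ∀ i ∈ s, HolderDom α ε (toMeasure (a i)) (toMeasure (b i))) :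
    HolderDom α (s.card * ε) (toMeasure (∏ i ∈ s, a i)) (toMeasure (∏ i ∈ s, b i)) := by
  classical
  induction s using Finset.induction_on with
  | empty =>
    simp only [Finset.prod_empty, toMeasure_one, Finset.card_empty, Nat.cast_zero, zero_mul]
    exact HolderDom.refl hα _
  | insert i s his ih =>
    rw [Finset.prod_insert his, Finset.prod_insert his, Finset.card_insert_of_notMem his]
    convert holderDom_mul hα (h i (Finset.mem_insert_self i s))
      (ih fun j hj => h j (Finset.mem_insert_of_mem hj)) using 1
    push_cast
    ring

theorem holderDom_pow (hα : 1 < α) {a b : Law G} (m : ℕ)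
    (h : HolderDom α ε (toMeasure a) (toMeasure b)) :
    HolderDom α (m * ε) (toMeasure (a ^ m)) (toMeasure (b ^ m)) := by
  simpa using holderDom_prod hα (Finset.range m) (a := fun _ => a) (b := fun _ => b) fun _ _ => h

end Law

/-! ### Expectations over independent coins and likelihood ratios -/

/-- The expectation of `f (k + S)`, where `S` is the number of heads in independent tosses of coins
with the given parameters. -/
def coinExp : List ℝ → (ℕ → ℝ) → ℕ → ℝ
  | [], f, k => f k
  | p :: l, f, k => (1 - p) * coinExp l f k + p * coinExp l f (k + 1)

section CoinExp

variable {l : List ℝ} {f g : ℕ → ℝ} {c : ℝ}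

theorem coinExp_add (l : List ℝ) (f g : ℕ → ℝ) (k : ℕ) :
    coinExp l (fun s => f s + g s) k = coinExp l f k + coinExp l g k := by
  induction l generalizing k with
  | nil => rfl
  | cons p l ih => simp only [coinExp, ih]; ring

theorem coinExp_const_mul (l : List ℝ) (c : ℝ) (f : ℕ → ℝ) (k : ℕ) :
    coinExp l (fun s => c * f s) k = c * coinExp l f k := by
  induction l generalizing k with
  | nil => rfl
  | cons p l ih => simp only [coinExp, ih]; ring

theorem coinExp_const (l : List ℝ) (c : ℝ) (k : ℕ) : coinExp l (fun _ => c) k = c := by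
  induction l generalizing k with
  | nil => rfl
  | cons p l ih => simp only [coinExp, ih]; ring

theorem coinExp_sub (l : List ℝ) (f g : ℕ → ℝ) (k : ℕ) :
    coinExp l (fun s => f s - g s) k = coinExp l f k - coinExp l g k := by
  have h := coinExp_add l f (fun s => -1 * g s) k
  rw [coinExp_const_mul] at h
  convert h using 2
  · ext s; ring
  · ring

theorem coinExp_mono (hl : ∀ p ∈ l, p ∈ Set.Icc (0 : ℝ) 1) {k : ℕ}
    (h : ∀ s, s ≤ k + l.length → f s ≤ g s) : coinExp l f k ≤ coinExp l g k := by
  induction l generalizing k with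
  | nil => exact h k (by simp)
  | cons p l ih =>
    have hp := hl p (by simp)
    have hl' : ∀ p ∈ l, p ∈ Set.Icc (0 : ℝ) 1 := fun q hq => hl q (by simp [hq])
    have h1 := ih hl' (k := k) fun s hs => h s (by simp; omega)
    have h2 := ih hl' (k := k + 1) fun s hs => h s (by simp; omega)
    have := hp.1
    have : 0 ≤ 1 - p := by linarith [hp.2]
    simp only [coinExp]
    gcongr

theorem coinExp_congr {k : ℕ} (h : ∀ s, s ≤ k + l.length → f s = g s) :
    coinExp l f k = coinExp l g k := by
  induction l generalizing k with
  | nil => exact h k (by simp)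
  | cons p l ih =>
    simp only [coinExp]
    rw [ih fun s hs => h s (by simp; omega), ih fun s hs => h s (by simp; omega)]

theorem coinExp_nonneg (hl : ∀ p ∈ l, p ∈ Set.Icc (0 : ℝ) 1) (hf : ∀ s, 0 ≤ f s) (k : ℕ) :
    0 ≤ coinExp l f k := by
  rw [← coinExp_const l 0 k]
  exact coinExp_mono hl fun s _ => hf s

theorem coinExp_id (l : List ℝ) (k : ℕ) : coinExp l (fun s => (s : ℝ)) k = k + l.sum := by
  induction l generalizing k with
  | nil => simp [coinExp]
  | cons p l ih => simp only [coinExp, ih, List.sum_cons]; push_cast; ring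

theorem coinExp_sq (l : List ℝ) (c : ℝ) (k : ℕ) :
    coinExp l (fun s => ((s : ℝ) - c) ^ 2) k =
      (k + l.sum - c) ^ 2 + (l.map fun p => p * (1 - p)).sum := by
  induction l generalizing k with
  | nil => simp [coinExp]
  | cons p l ih => simp only [coinExp, ih, List.sum_cons, List.map_cons]; push_cast; ring

/-- Coupling: both sides use the same tosses, started one apart. -/
theorem coinExp_lipschitz (hl : ∀ p ∈ l, p ∈ Set.Icc (0 : ℝ) 1) {k : ℕ}
    (h : ∀ s, s ≤ k + l.length → |f (s + 1) - f s| ≤ c) :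
    |coinExp l f (k + 1) - coinExp l f k| ≤ c := by
  induction l generalizing k with
  | nil => exact h k (by simp)
  | cons p l ih =>
    have hp := hl p (by simp)
    have hl' : ∀ p ∈ l, p ∈ Set.Icc (0 : ℝ) 1 := fun q hq => hl q (by simp [hq])
    have h1 := ih hl' (k := k) fun s hs => h s (by simp; omega)
    have h2 := ih hl' (k := k + 1) fun s hs => h s (by simp; omega)
    simp only [coinExp]
    rw [abs_le] at *
    constructor <;> nlinarith [hp.1, hp.2, h1.1, h1.2, h2.1, h2.2]

theorem coinExp_cons_sub_le (hl : ∀ p ∈ l, p ∈ Set.Icc (0 : ℝ) 1) {p p' : ℝ} {k : ℕ}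
    (h : ∀ s, s ≤ k + l.length → |f (s + 1) - f s| ≤ c) :
    coinExp (p :: l) f k - coinExp (p' :: l) f k ≤ |p - p'| * c := by
  have h1 := coinExp_lipschitz hl h
  calc coinExp (p :: l) f k - coinExp (p' :: l) f k
      = (p - p') * (coinExp l f (k + 1) - coinExp l f k) := by simp only [coinExp]; ring
    _ ≤ |p - p'| * |coinExp l f (k + 1) - coinExp l f k| := by
        rw [← abs_mul]; exact le_abs_self _
    _ ≤ _ := by gcongr

/-- Hoeffding's lemma for a variable with two values. -/
theorem two_point_exp_le {p : ℝ} (hp : p ∈ Set.Icc (0 : ℝ) 1) (a b : ℝ) :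
    (1 - p) * Real.exp a + p * Real.exp b ≤
      Real.exp ((1 - p) * a + p * b + (b - a) ^ 2 / 2) := by
  obtain ⟨hp0, hp1⟩ := hp
  have hq0 : 0 ≤ 1 - p := by linarith
  set t := b - a with ht
  have hb : Real.exp b = Real.exp a * Real.exp t := by rw [← Real.exp_add]; congr 1; ring
  -- Jensen's inequality brings in an independent copy. The difference of the two copies is
  -- symmetric, so only a `cosh` remains to be bounded; this loses a constant against the sharp `1 /
  -- 8`.
  have hconv : Real.exp (-(p * t)) ≤ (1 - p) + p * Real.exp (-t) := by
    have := convexOn_exp.2 (Set.mem_univ (0 : ℝ)) (Set.mem_univ (-t)) hq0 hp0 (by ring)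
    simp only [smul_eq_mul, mul_zero, zero_add, Real.exp_zero, mul_one] at this
    rwa [mul_neg] at this
  have hcosh : Real.exp t + Real.exp (-t) ≤ 2 * Real.exp (t ^ 2 / 2) := by
    have := Real.cosh_le_exp_half_sq t
    rw [Real.cosh_eq] at this
    linarith
  have hmul : Real.exp t * Real.exp (-t) = 1 := by rw [← Real.exp_add]; simp
  have hone : 1 ≤ Real.exp (t ^ 2 / 2) := Real.one_le_exp (by positivity)
  have hmain : ((1 - p) + p * Real.exp t) * Real.exp (-(p * t)) ≤ Real.exp (t ^ 2 / 2) := by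
    calc ((1 - p) + p * Real.exp t) * Real.exp (-(p * t))
        ≤ ((1 - p) + p * Real.exp t) * ((1 - p) + p * Real.exp (-t)) := by
          gcongr
      _ = (1 - p) ^ 2 + p ^ 2 * (Real.exp t * Real.exp (-t)) +
            p * (1 - p) * (Real.exp t + Real.exp (-t)) := by ring
      _ ≤ (1 - p) ^ 2 + p ^ 2 * 1 + p * (1 - p) * (2 * Real.exp (t ^ 2 / 2)) := by
          rw [hmul]; gcongr
      _ ≤ ((1 - p) ^ 2 + p ^ 2) * Real.exp (t ^ 2 / 2) +
            p * (1 - p) * (2 * Real.exp (t ^ 2 / 2)) := by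
          nlinarith [sq_nonneg (1 - p), sq_nonneg p]
      _ = Real.exp (t ^ 2 / 2) := by ring
  calc (1 - p) * Real.exp a + p * Real.exp b
      = Real.exp (a + p * t) * (((1 - p) + p * Real.exp t) * Real.exp (-(p * t))) := by
        rw [hb, Real.exp_add]
        have : Real.exp (p * t) * Real.exp (-(p * t)) = 1 := by rw [← Real.exp_add]; simp
        linear_combination (-(1 - p) * Real.exp a - p * Real.exp a * Real.exp t) * this
    _ ≤ Real.exp (a + p * t) * Real.exp (t ^ 2 / 2) := by gcongr
    _ = _ := by rw [← Real.exp_add]; congr 1; rw [ht]; ring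

/-- McDiarmid's bound on the moment generating function for functions of the number of heads. -/
theorem coinExp_exp_le (hl : ∀ p ∈ l, p ∈ Set.Icc (0 : ℝ) 1) {k : ℕ}
    (h : ∀ s, s < k + l.length → |f (s + 1) - f s| ≤ c) :
    coinExp l (fun s => Real.exp (f s)) k ≤
      Real.exp (coinExp l f k + l.length * (c ^ 2 / 2)) := by
  induction l generalizing k with
  | nil => simp [coinExp]
  | cons p l ih =>
    have hp := hl p (by simp)
    have hl' : ∀ p ∈ l, p ∈ Set.Icc (0 : ℝ) 1 := fun q hq => hl q (by simp [hq])
    have h1 := ih hl' (k := k) fun s hs => h s (by simp; omega)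
    have h2 := ih hl' (k := k + 1) fun s hs => h s (by simp; omega)
    have h3 := coinExp_lipschitz (k := k) hl' (f := f) (c := c)
      fun s hs => h s (by simp; omega)
    have := hp.1
    have : 0 ≤ 1 - p := by linarith [hp.2]
    have h4 : (coinExp l f (k + 1) - coinExp l f k) ^ 2 ≤ c ^ 2 := by
      rw [← sq_abs]; gcongr
    simp only [coinExp, List.length_cons]
    calc _ ≤ (1 - p) * Real.exp (coinExp l f k + l.length * (c ^ 2 / 2)) +
          p * Real.exp (coinExp l f (k + 1) + l.length * (c ^ 2 / 2)) := by gcongr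
      _ ≤ _ := two_point_exp_le hp _ _
      _ ≤ _ := by
        refine Real.exp_le_exp.2 ?_
        rw [add_sub_add_right_eq_sub]
        push_cast
        linarith

/-- The size-bias identity `s * C(N+1, s) = (N+1) * C(N, s-1)` in expectation form. It shows how
weighting by the number of heads turns one coin into a certain head. -/
theorem coinExp_replicate_sub_mul (q : ℝ) (g : ℕ → ℝ) (N k : ℕ) :
    coinExp (List.replicate (N + 1) q) (fun s => ((s : ℝ) - k) * g s) k =
      (N + 1) * q * coinExp (List.replicate N q) g (k + 1) := by
  induction N generalizing k with
  | zero => simp [coinExp]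
  | succ N ih =>
    have e : ∀ s : ℕ, ((s : ℝ) - k) * g s = ((s : ℝ) - (k + 1 : ℕ)) * g s + g s := fun s => by
      push_cast; ring
    rw [List.replicate_succ, coinExp, ih]
    simp_rw [e]
    rw [coinExp_add, ih, List.replicate_succ, coinExp]
    push_cast
    ring

/-- The density of the number of heads of a `p`-coin and `N` coins of parameter `q` with respect
to the binomial distribution with parameters `N + 1` and `q`. -/
def tilt (N : ℕ) (q p : ℝ) (s : ℕ) : ℝ :=
  (1 - p) * ((1 - s / (N + 1)) / (1 - q)) + p * (s / (N + 1) / q)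

theorem coinExp_cons_replicate {q : ℝ} (hq0 : q ≠ 0) (hq1 : 1 - q ≠ 0) (N : ℕ) (p : ℝ)
    (g : ℕ → ℝ) :
    coinExp (p :: List.replicate N q) g 0 =
      coinExp (List.replicate (N + 1) q) (fun s => tilt N q p s * g s) 0 := by
  have h1 := coinExp_replicate_sub_mul q g N 0
  simp only [Nat.cast_zero, sub_zero, zero_add] at h1
  have e : ∀ s : ℕ, tilt N q p s * g s =
      (1 - p) / (1 - q) * g s + (p / q - (1 - p) / (1 - q)) / (N + 1) * (s * g s) := fun s => by
    rw [tilt]; field_simp; ring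
  simp_rw [e]
  rw [coinExp_add, coinExp_const_mul, coinExp_const_mul, h1, List.replicate_succ, coinExp, coinExp]
  field_simp
  ring

variable {N : ℕ} {q p p' θ : ℝ}

/-- Since `q` and `1 - q` are at most `3/4`, both quotients gain a factor `4/3`; the weights `p` and
`1 - p` are at least `1/4`. -/
theorem third_le_tilt (hq : q ∈ Set.Icc (1 / 4 : ℝ) (3 / 4)) (hp : p ∈ Set.Icc (1 / 4 : ℝ) (3 / 4))
    {s : ℕ} (hs : s ≤ N + 1) : 1 / 3 ≤ tilt N q p s := by
  have hN : (0 : ℝ) < N + 1 := by positivity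
  have ht1 : (s : ℝ) / (N + 1) ≤ 1 := by rw [div_le_one hN]; exact_mod_cast hs
  have ht0 : 0 ≤ (s : ℝ) / (N + 1) := by positivity
  rw [tilt]
  set t := (s : ℝ) / (N + 1)
  have hA : 4 / 3 * t ≤ t / q := by
    rw [le_div_iff₀ (by linarith [hq.1])]; nlinarith [hq.2]
  have hB : 4 / 3 * (1 - t) ≤ (1 - t) / (1 - q) := by
    rw [le_div_iff₀ (by linarith [hq.2])]; nlinarith [hq.1]
  have hA0 : 0 ≤ t / q := by linarith
  have hB0 : 0 ≤ (1 - t) / (1 - q) := by linarith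
  nlinarith [hp.1, hp.2]

/-- Both tilts are affine in `s`, so the numerator of the difference of consecutive quotients is a
determinant that does not depend on `s`. With `q * (1 - q) ≥ 3/16` and denominators at least `1/9`,
the constant is `2 * (16/3) * 9 = 96`. -/
theorem abs_tilt_div_sub_le (hq : q ∈ Set.Icc (1 / 4 : ℝ) (3 / 4))
    (hp' : p' ∈ Set.Icc (1 / 4 : ℝ) (3 / 4)) (h : |p - p'| ≤ 2 * θ) {s : ℕ} (hs : s < N + 1) :
    |tilt N q p (s + 1) / tilt N q p' (s + 1) - tilt N q p s / tilt N q p' s| ≤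
      96 * θ / (N + 1) := by
  have hN : (0 : ℝ) < N + 1 := by positivity
  have hq0 : 0 < q := by linarith [hq.1]
  have hq1 : 0 < 1 - q := by linarith [hq.2]
  have h1 := third_le_tilt hq hp' (s := s) (N := N) hs.le
  have h2 := third_le_tilt hq hp' (s := s + 1) (N := N) hs
  have e : tilt N q p (s + 1) * tilt N q p' s - tilt N q p' (s + 1) * tilt N q p s =
      (p - p') / (q * (1 - q) * (N + 1)) := by
    simp only [tilt]; push_cast; field_simp; ring
  have hθ : 0 ≤ θ := by linarith [abs_nonneg (p - p')]
  have hqq : 3 / 16 ≤ q * (1 - q) := by nlinarith [hq.1, hq.2]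
  rw [div_sub_div _ _ (by positivity) (by positivity), e, abs_div, abs_div,
    abs_of_pos (a := q * (1 - q) * (N + 1)) (by positivity),
    abs_of_pos (a := tilt N q p' (s + 1) * tilt N q p' s) (by positivity)]
  have h3 : 1 / 9 ≤ tilt N q p' (s + 1) * tilt N q p' s := by nlinarith
  rw [div_div]
  calc |p - p'| / (q * (1 - q) * (N + 1) * (tilt N q p' (s + 1) * tilt N q p' s))
      ≤ 2 * θ / (3 / 16 * (N + 1) * (1 / 9)) := by gcongr
    _ = 96 * θ / (N + 1) := by field_simp; ring

end CoinExp

/-! ### Privacy of one coin among `n` -/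

namespace Law

theorem toMeasure_coin_mul {G : Type*} [AddCommMonoid G] [MeasurableSpace G] [MeasurableAdd₂ G]
    (v : G) (p : ℝ) (a : Law G) :
    toMeasure (coin v p * a) = ENNReal.ofReal (1 - p) • toMeasure a +
      ENNReal.ofReal p • (toMeasure a).map (v + ·) := by
  rw [toMeasure_mul, coin, map_add, toMeasure_single, toMeasure_single, Measure.add_conv,
    Measure.conv_smul_left, Measure.conv_smul_left, Measure.dirac_zero_conv, Measure.dirac_conv]

/-- The law of the number of heads in independent tosses of coins with the given parameters. -/
def coins (l : List ℝ) : Law ℕ := (l.map (coin 1)).prod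

@[simp]
theorem coins_cons (p : ℝ) (l : List ℝ) : coins (p :: l) = coin 1 p * coins l := by
  simp [coins]

theorem coins_replicate (N : ℕ) (q : ℝ) : coins (List.replicate N q) = coin 1 q ^ N := by
  simp [coins]

variable {l : List ℝ}

theorem lintegral_coins (hl : ∀ p ∈ l, p ∈ Set.Icc (0 : ℝ) 1) {f : ℕ → ℝ} (hf : ∀ s, 0 ≤ f s)
    (k : ℕ) :
    ∫⁻ s, ENNReal.ofReal (f (k + s)) ∂(toMeasure (coins l)) = ENNReal.ofReal (coinExp l f k) := by
  induction l generalizing k with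
  | nil => simp [coins, coinExp]
  | cons p l ih =>
    have hp := hl p (by simp)
    have hl' : ∀ p ∈ l, p ∈ Set.Icc (0 : ℝ) 1 := fun q hq => hl q (by simp [hq])
    have hp' : 0 ≤ 1 - p := by linarith [hp.2]
    rw [coins_cons, toMeasure_coin_mul, lintegral_add_measure, lintegral_smul_measure,
      lintegral_smul_measure, lintegral_map .of_discrete .of_discrete, ih hl']
    simp_rw [← add_assoc]
    rw [ih hl', smul_eq_mul, smul_eq_mul, ← ENNReal.ofReal_mul hp', ← ENNReal.ofReal_mul hp.1,
      ← ENNReal.ofReal_add (mul_nonneg hp' (coinExp_nonneg hl' hf _))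
        (mul_nonneg hp.1 (coinExp_nonneg hl' hf _))]
    rfl

theorem integrable_coins (l : List ℝ) (f : ℕ → ℝ) : Integrable f (toMeasure (coins l)) := by
  induction l generalizing f with
  | nil => simpa [coins] using integrable_dirac (by simp)
  | cons p l ih =>
    rw [coins_cons, toMeasure_coin_mul]
    refine ((ih f).smul_measure (by simp)).add_measure (.smul_measure ?_ (by simp))
    exact (integrable_map_measure .of_discrete .of_discrete).2 (ih _)

theorem integral_coins (hl : ∀ p ∈ l, p ∈ Set.Icc (0 : ℝ) 1) (f : ℕ → ℝ) (k : ℕ) :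
    ∫ s, f (k + s) ∂(toMeasure (coins l)) = coinExp l f k := by
  induction l generalizing k with
  | nil => simp [coins, coinExp]
  | cons p l ih =>
    have hp := hl p (by simp)
    have hl' : ∀ p ∈ l, p ∈ Set.Icc (0 : ℝ) 1 := fun q hq => hl q (by simp [hq])
    have hp' : 0 ≤ 1 - p := by linarith [hp.2]
    rw [coins_cons, toMeasure_coin_mul, integral_add_measure
      ((integrable_coins l _).smul_measure (by simp))
      (.smul_measure ((integrable_map_measure .of_discrete .of_discrete).2
        (integrable_coins l _)) (by simp)), integral_smul_measure,
      integral_smul_measure, integral_map .of_discrete .of_discrete, ih hl']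
    simp_rw [← add_assoc]
    rw [ih hl', ENNReal.toReal_ofReal hp', ENNReal.toReal_ofReal hp.1]
    rfl

theorem isProbabilityMeasure_coins (hl : ∀ p ∈ l, p ∈ Set.Icc (0 : ℝ) 1) :
    IsProbabilityMeasure (toMeasure (coins l)) := by
  constructor
  have := lintegral_coins hl (f := fun _ => 1) (fun _ => zero_le_one) 0
  simpa [coinExp_const] using this

variable {N : ℕ} {q p p' θ α : ℝ}

theorem coins_singleton (hl : ∀ p ∈ l, p ∈ Set.Icc (0 : ℝ) 1) (t : ℕ) :
    toMeasure (coins l) {t} = ENNReal.ofReal (coinExp l (fun s => if s = t then 1 else 0) 0) := by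
  rw [← lintegral_coins hl (fun s => by split_ifs <;> simp), ← lintegral_indicator_one .of_discrete]
  refine lintegral_congr fun s => ?_
  by_cases h : s = t <;> simp [h]

/-- Both laws have a `tilt` as density with respect to the same binomial law, so their likelihood
ratio is explicit, and its small increments give subgaussian concentration. -/
theorem holderDom_coin_mul_pow (hα : 1 < α) (hq : q ∈ Set.Icc (1 / 4 : ℝ) (3 / 4))
    (hp : p ∈ Set.Icc (1 / 4 : ℝ) (3 / 4)) (hp' : p' ∈ Set.Icc (1 / 4 : ℝ) (3 / 4))
    (h : |p - p'| ≤ 2 * θ) :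
    HolderDom α (4608 * α * θ ^ 2 / (N + 1)) (toMeasure (coin 1 p * coin 1 q ^ N))
      (toMeasure (coin 1 p' * coin 1 q ^ N)) := by
  have hN : (0 : ℝ) < N + 1 := by positivity
  have hθ : 0 ≤ θ := by linarith [abs_nonneg (p - p')]
  have hα' : 0 < α - 1 := by linarith
  have hq0 : q ≠ 0 := by linarith [hq.1]
  have hq1 : 1 - q ≠ 0 := by linarith [hq.2]
  have sub : ∀ x : ℝ, x ∈ Set.Icc (1 / 4 : ℝ) (3 / 4) → x ∈ Set.Icc (0 : ℝ) 1 := fun x hx =>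
    ⟨by linarith [hx.1], by linarith [hx.2]⟩
  have hrep : ∀ x ∈ List.replicate N q, x ∈ Set.Icc (0 : ℝ) 1 := fun x hx => by
    rw [List.eq_of_mem_replicate hx]; exact sub q hq
  have hrep' : ∀ x ∈ List.replicate (N + 1) q, x ∈ Set.Icc (0 : ℝ) 1 := fun x hx => by
    rw [List.eq_of_mem_replicate hx]; exact sub q hq
  have hl : ∀ r : ℝ, r ∈ Set.Icc (1 / 4 : ℝ) (3 / 4) → ∀ x ∈ r :: List.replicate N q,
      x ∈ Set.Icc (0 : ℝ) 1 := fun r hr x hx => by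
    rcases List.mem_cons.1 hx with rfl | hx
    · exact sub _ hr
    · exact hrep x hx
  rw [← coins_replicate, ← coins_cons, ← coins_cons]
  -- Beyond the support a tilt can be negative or zero; the value `1` keeps `ρ` nonnegative
  -- everywhere.
  set ρ : ℕ → ℝ := fun s => if s ≤ N + 1 then tilt N q p s / tilt N q p' s else 1 with hρdef
  have hρle : ∀ {s}, s ≤ N + 1 → ρ s = tilt N q p s / tilt N q p' s := fun hs => if_pos hs
  have hρ0 : ∀ s, 0 ≤ ρ s := by
    intro s
    simp only [hρdef]
    split_ifs with hs
    · have h1 := third_le_tilt hq hp hs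
      have h2 := third_le_tilt hq hp' hs
      exact div_nonneg (by linarith) (by linarith)
    · exact zero_le_one
  have hρlip : ∀ s, s < N + 1 → |ρ (s + 1) - ρ s| ≤ 96 * θ / (N + 1) := fun s hs => by
    rw [hρle hs.le, hρle (by omega : s + 1 ≤ N + 1)]
    exact abs_tilt_div_sub_le hq hp' h hs
  have htilt : ∀ g : ℕ → ℝ, coinExp (p' :: List.replicate N q) (fun s => ρ s * g s) 0 =
      coinExp (p :: List.replicate N q) g 0 := by
    intro g
    rw [coinExp_cons_replicate hq0 hq1, coinExp_cons_replicate hq0 hq1]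
    refine coinExp_congr fun s hs => ?_
    have hs' : s ≤ N + 1 := by simpa using hs
    have := third_le_tilt hq hp' hs'
    have h0 : tilt N q p' s ≠ 0 := by linarith
    rw [hρle hs']
    field_simp
  have hdens : toMeasure (coins (p :: List.replicate N q)) =
      (toMeasure (coins (p' :: List.replicate N q))).withDensity
        fun s => ENNReal.ofReal (ρ s) := by
    refine Measure.ext_of_singleton fun t => ?_
    rw [withDensity_apply _ .of_discrete, lintegral_singleton, coins_singleton (hl p hp),
      coins_singleton (hl p' hp'), ← ENNReal.ofReal_mul (hρ0 t), ← htilt, ← coinExp_const_mul]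
    congr 2
    ext s
    by_cases hst : s = t <;> simp [hst]
  rw [hdens]
  refine HolderDom.of_density hα .of_discrete ?_
  have hmean : coinExp (p' :: List.replicate N q) ρ 0 = 1 := by
    have := htilt fun _ => 1
    simpa [coinExp_const] using this
  calc ∫⁻ s, ENNReal.ofReal (ρ s) ^ α ∂(toMeasure (coins (p' :: List.replicate N q)))
      = ∫⁻ s, ENNReal.ofReal (ρ (0 + s) ^ α) ∂(toMeasure (coins (p' :: List.replicate N q))) := by
        refine lintegral_congr fun s => ?_
        rw [zero_add, ENNReal.ofReal_rpow_of_nonneg (hρ0 s) (by linarith)]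
    _ = ENNReal.ofReal (coinExp (p' :: List.replicate N q) (fun s => ρ s ^ α) 0) :=
        lintegral_coins (f := fun s => ρ s ^ α) (hl p' hp') (fun s => Real.rpow_nonneg (hρ0 s) _) 0
    -- One factor `ρ` is absorbed by the change of measure from `p'` to `p`.
    _ = ENNReal.ofReal (coinExp (p :: List.replicate N q) (fun s => ρ s ^ (α - 1)) 0) := by
        rw [← htilt]
        congr 2
        ext s
        conv_lhs => rw [show α = 1 + (α - 1) by ring,
          Real.rpow_add_of_nonneg (hρ0 s) zero_le_one hα'.le, Real.rpow_one]
    _ ≤ ENNReal.ofReal (coinExp (p :: List.replicate N q)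
          (fun s => Real.exp ((α - 1) * (ρ s - 1))) 0) := by
        refine ENNReal.ofReal_le_ofReal (coinExp_mono (hl p hp) fun s _ => ?_)
        calc ρ s ^ (α - 1) ≤ Real.exp (ρ s - 1) ^ (α - 1) := by
              refine Real.rpow_le_rpow (hρ0 s) ?_ hα'.le
              linarith [Real.add_one_le_exp (ρ s - 1)]
          _ = _ := by rw [← Real.exp_mul, mul_comm]
    _ ≤ _ := by
        refine ENNReal.ofReal_le_ofReal ?_
        refine (coinExp_exp_le (hl p hp) (c := (α - 1) * (96 * θ / (N + 1)))
          fun s hs => ?_).trans ?_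
        · rw [← mul_sub, sub_sub_sub_cancel_right, abs_mul, abs_of_pos hα']
          gcongr
          exact hρlip s (by simpa using hs)
        · refine Real.exp_le_exp.2 ?_
          -- The mean of `ρ` is `1` under `p'`, so under `p` it exceeds `1` by at most the change of
          -- parameter times the Lipschitz constant.
          have h1 := coinExp_cons_sub_le (l := List.replicate N q) (p := p) (p' := p') (k := 0)
            hrep fun s hs => hρlip s (by simp at hs; omega)
          rw [coinExp_const_mul, coinExp_sub, coinExp_const]
          rw [hmean] at h1
          have h2 : |p - p'| * (96 * θ / (N + 1)) ≤ 2 * θ * (96 * θ / (N + 1)) := by gcongr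
          have h3 : (α - 1) * (coinExp (p :: List.replicate N q) ρ 0 - 1) ≤
              (α - 1) * (2 * θ * (96 * θ / (N + 1))) := by
            gcongr; linarith
          simp only [List.length_cons, List.length_replicate, Nat.cast_add, Nat.cast_one]
          -- The variance term has constant `96² / 2 = 4608` and the mean term `2 * 96 = 192`; the
          -- slack `4416 = 4608 - 192` turns their sum into `4608 * α * (α - 1)`.
          have e1 : ((N : ℝ) + 1) * (((α - 1) * (96 * θ / (N + 1))) ^ 2 / 2) =
              (α - 1) ^ 2 * (4608 * θ ^ 2 / (N + 1)) := by field_simp; ring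
          have e2 : (α - 1) * (2 * θ * (96 * θ / (N + 1))) =
              (α - 1) * (192 * θ ^ 2 / (N + 1)) := by ring
          have e3 : (α - 1) * (4608 * α * θ ^ 2 / (N + 1)) =
            (α - 1) ^ 2 * (4608 * θ ^ 2 / (N + 1)) + (α - 1) * (192 * θ ^ 2 / (N + 1)) +
              (α - 1) * (4416 * θ ^ 2 / (N + 1)) := by ring
          have h4 : 0 ≤ (α - 1) * (4416 * θ ^ 2 / (N + 1)) := by positivity
          rw [e1, e3]
          linarith

/-- The counters `a` and `b` record how the coins processed so far were split into extreme ones.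
Each step keeps the total number of coins, so both branches of the mixture satisfy the same bound.
-/
theorem holderDom_coin_mul_coins (hα : 1 < α) (hp : p ∈ Set.Icc (1 / 4 : ℝ) (3 / 4))
    (hp' : p' ∈ Set.Icc (1 / 4 : ℝ) (3 / 4)) (h : |p - p'| ≤ 2 * θ)
    (hl : ∀ r ∈ l, r ∈ Set.Icc (1 / 4 : ℝ) (3 / 4)) (a b : ℕ) :
    HolderDom α (9216 * α * θ ^ 2 / (a + b + l.length + 1))
      (toMeasure (coin 1 p * (coin 1 (1 / 4) ^ a * coin 1 (3 / 4) ^ b * coins l)))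
      (toMeasure (coin 1 p' * (coin 1 (1 / 4) ^ a * coin 1 (3 / 4) ^ b * coins l))) := by
  induction l generalizing a b with
  | nil =>
    have h1 : (1 / 4 : ℝ) ∈ Set.Icc (1 / 4 : ℝ) (3 / 4) := by norm_num
    have h3 : (3 / 4 : ℝ) ∈ Set.Icc (1 / 4 : ℝ) (3 / 4) := by norm_num
    have hr : ∀ (q : ℝ) (N : ℕ), q ∈ Set.Icc (1 / 4 : ℝ) (3 / 4) →
        HolderDom α 0 (toMeasure (coin 1 q ^ N : Law ℕ)) (toMeasure (coin 1 q ^ N)) := by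
      intro q N hq
      rw [← coins_replicate]
      have := isProbabilityMeasure_coins (l := List.replicate N q) fun x hx => by
        rw [List.eq_of_mem_replicate hx]; exact ⟨by linarith [hq.1], by linarith [hq.2]⟩
      exact HolderDom.refl hα _
    -- Dropping the smaller group of `M` coins costs nothing in the divergence and at most a factor
    -- `2` in the number of coins.
    have hε : ∀ N M : ℕ, M ≤ N →
        4608 * α * θ ^ 2 / (N + 1) + 0 ≤ 9216 * α * θ ^ 2 / ((N + M : ℕ) + 1) := by
      intro N M hNM
      have hNM' : (M : ℝ) ≤ N := by exact_mod_cast hNM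
      have hα0 : 0 < α := by linarith
      rw [add_zero, div_le_div_iff₀ (by positivity) (by positivity)]
      have : 0 ≤ α * θ ^ 2 := by positivity
      push_cast
      nlinarith
    simp only [coins, List.map_nil, List.prod_nil, mul_one, List.length_nil, Nat.cast_zero,
      add_zero]
    rcases le_total b a with hab | hab
    · rw [← mul_assoc, ← mul_assoc]
      have := (holderDom_mul hα (holderDom_coin_mul_pow (N := a) hα h1 hp hp' h)
        (hr _ b h3)).mono hα (hε a b hab)
      push_cast at this
      exact this
    · rw [mul_comm (coin 1 (1 / 4) ^ a), ← mul_assoc, ← mul_assoc]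
      have := (holderDom_mul hα (holderDom_coin_mul_pow (N := b) hα h3 hp hp' h)
        (hr _ a h1)).mono hα (hε b a hab)
      push_cast at this
      rwa [add_comm (b : ℝ)] at this
  | cons r l ih =>
    have hr := hl r (by simp)
    have hl' : ∀ r ∈ l, r ∈ Set.Icc (1 / 4 : ℝ) (3 / 4) := fun q hq => hl q (by simp [hq])
    -- The weight `w = 2r - 1/2` solves `(1 - w) / 4 + 3w / 4 = r`.
    have hw : 2 * r - 1 / 2 ∈ Set.Icc (0 : ℝ) 1 := ⟨by linarith [hr.1], by linarith [hr.2]⟩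
    have hmix := coin_mix (1 : ℕ) (p := 1 / 4) (q := 3 / 4) (w := 2 * r - 1 / 2) (by norm_num)
      (by norm_num) hw
    rw [show (1 - (2 * r - 1 / 2)) * (1 / 4) + (2 * r - 1 / 2) * (3 / 4) = r by ring] at hmix
    have hsplit : ∀ x : Law ℕ, x * (coin 1 (1 / 4) ^ a * coin 1 (3 / 4) ^ b * coins (r :: l)) =
        ENNReal.ofReal (1 - (2 * r - 1 / 2)) •
          (x * (coin 1 (1 / 4) ^ (a + 1) * coin 1 (3 / 4) ^ b * coins l)) +
        ENNReal.ofReal (2 * r - 1 / 2) •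
          (x * (coin 1 (1 / 4) ^ a * coin 1 (3 / 4) ^ (b + 1) * coins l)) := by
      intro x
      rw [coins_cons, hmix, pow_succ, pow_succ]
      simp only [add_mul, mul_add, smul_mul_assoc, mul_smul_comm]
      congr 2 <;> ring
    rw [hsplit, hsplit]
    simp only [map_add, toMeasure_smul]
    refine HolderDom.mix hα ?_ ?_ ?_
    · rw [← ENNReal.ofReal_add (by linarith [hw.2]) hw.1]; simp
    · convert ih hl' (a + 1) b using 2
      simp only [List.length_cons]; push_cast; ring
    · convert ih hl' a (b + 1) using 2
      simp only [List.length_cons]; push_cast; ring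

/-- Changing the parameter of one coin out of `n`, from one value in `[1/4, 3/4]` to another at
distance at most `2θ`. -/
theorem holderDom_prod_coin {G : Type*} [AddCommMonoid G] [MeasurableSpace G] [MeasurableAdd₂ G]
    (v : G) (hα : 1 < α) {n : ℕ} {p p' : Fin n → ℝ} (i₀ : Fin n)
    (hp : ∀ i, p i ∈ Set.Icc (1 / 4 : ℝ) (3 / 4)) (hp' : ∀ i, p' i ∈ Set.Icc (1 / 4 : ℝ) (3 / 4))
    (h : |p i₀ - p' i₀| ≤ 2 * θ) (heq : ∀ i, i ≠ i₀ → p i = p' i) :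
    HolderDom α (9216 * α * θ ^ 2 / n) (toMeasure (∏ i, coin v (p i)))
      (toMeasure (∏ i, coin v (p' i))) := by
  -- The comparison takes place in `ℕ`, where heads can be counted, and is pushed forward along `k ↦
  -- k • v`.
  have key : ∀ r : Fin n → ℝ, ∏ i, coin v (r i) =
      map (multiplesHom G v) (coin 1 (r i₀) *
        (coin 1 (1 / 4) ^ 0 * coin 1 (3 / 4) ^ 0 *
          coins ((Finset.univ.erase i₀).toList.map r))) := by
    intro r
    rw [coins, List.map_map, Finset.prod_map_toList, pow_zero, pow_zero, one_mul, one_mul,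
      Function.comp_def, Finset.mul_prod_erase Finset.univ (fun i => coin (1 : ℕ) (r i))
        (Finset.mem_univ i₀), map_prod]
    refine Finset.prod_congr rfl fun i _ => ?_
    rw [map_coin]
    simp
  have hlist : (Finset.univ.erase i₀).toList.map p' = (Finset.univ.erase i₀).toList.map p := by
    refine List.map_congr_left fun i hi => (heq i ?_).symm
    simpa using hi
  have hn : 0 < n := i₀.pos
  rw [key, key, toMeasure_map _ .of_discrete, toMeasure_map _ .of_discrete, hlist]
  refine HolderDom.map ?_ .of_discrete
  convert holderDom_coin_mul_coins hα (hp i₀) (hp' i₀) h (l := (Finset.univ.erase i₀).toList.map p)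
    (fun x hx => ?_) 0 0 using 2
  · have : ((n - 1 : ℕ) : ℝ) = n - 1 := by
      push_cast [Nat.cast_sub (Nat.one_le_iff_ne_zero.2 hn.ne')]; ring
    simp [this]
  · obtain ⟨i, -, rfl⟩ := List.mem_map.1 hx
    exact hp i

end Law

/-! ### Tight frames -/

section Frame

variable {d D : ℕ} {u : Fin D → EuclideanSpace ℝ (Fin d)}

theorem IsTightFrame.dim_le (hu : IsTightFrame u) : d ≤ D := by
  let T : EuclideanSpace ℝ (Fin d) →ₗ[ℝ] Fin D → ℝ :=
    LinearMap.pi fun j => (innerSL ℝ (u j)).toLinearMap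
  have hT : ∀ x j, T x j = inner ℝ (u j) x := fun x j => rfl
  have hinj : Function.Injective T := by
    refine (injective_iff_map_eq_zero T).2 fun x hx => ?_
    have h := hu x
    simp_rw [← hT, hx] at h
    simpa using h
  simpa using LinearMap.finrank_le_finrank_of_injective hinj

/-- Synthesis is the adjoint of the isometric analysis map, hence a contraction; concretely,
Cauchy–Schwarz is applied to the inner product of the sum with itself. -/
theorem IsTightFrame.norm_sum_sq_le (hu : IsTightFrame u) (a : Fin D → ℝ) :
    ‖∑ j, a j • u j‖ ^ 2 ≤ ∑ j, a j ^ 2 := by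
  set v := ∑ j, a j • u j with hv
  have h1 : ‖v‖ ^ 2 = ∑ j, a j * inner ℝ (u j) v := by
    rw [← real_inner_self_eq_norm_sq]
    conv_lhs => rw [hv, sum_inner]
    simp_rw [inner_smul_left]
    rfl
  have h2 := Finset.sum_mul_sq_le_sq_mul_sq Finset.univ a fun j => inner ℝ (u j) v
  rw [← h1, ← hu v] at h2
  rcases (sq_nonneg ‖v‖).eq_or_lt' with h0 | h0
  · rw [h0]; positivity
  · nlinarith

theorem abs_rep_le {c K : ℝ} (hK : 0 < K) (hd : 0 < d) (hu : IsTightFrame u)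
    {x : EuclideanSpace ℝ (Fin d)} {a : Fin D → ℝ} (hx : ‖x‖ ≤ c) (ha : IsKashinRep u K x a)
    (j : Fin D) : |a j| ≤ coeffBound d c K := by
  have hdD : (d : ℝ) ≤ D := by exact_mod_cast hu.dim_le
  have hd' : (0 : ℝ) < d := by exact_mod_cast hd
  have : 0 < √(d : ℝ) := Real.sqrt_pos.2 hd'
  calc |a j| ≤ K / √D * ‖x‖ := ha.2 j
    _ ≤ K / √d * c := by gcongr
    _ = coeffBound d c K := by rw [coeffBound]; ring

end Frame

/-! ### Law of the aggregate, privacy, moments and cost -/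

section Mechanism

variable {n m D : ℕ} {c' θ : ℝ}

theorem prob_mem {y : ℝ} (hc' : 0 < c') (hθ : θ ∈ Set.Icc (0 : ℝ) (1 / 4)) (hy : |y| ≤ c') :
    θ / c' * y + 1 / 2 ∈ Set.Icc (1 / 4 : ℝ) (3 / 4) := by
  have h : |θ / c' * y| ≤ θ := by
    rw [abs_mul, abs_of_nonneg (div_nonneg hθ.1 hc'.le)]
    calc θ / c' * |y| ≤ θ / c' * c' := by gcongr; exact div_nonneg hθ.1 hc'.le
      _ = θ := by field_simp
  rw [abs_le] at h
  exact ⟨by linarith [hθ.2], by linarith [hθ.2]⟩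

theorem abs_prob_sub_le {y y' : ℝ} (hc' : 0 < c') (hθ : θ ∈ Set.Icc (0 : ℝ) (1 / 4))
    (hy : |y| ≤ c') (hy' : |y'| ≤ c') :
    |θ / c' * y + 1 / 2 - (θ / c' * y' + 1 / 2)| ≤ 2 * θ := by
  have h0 : 0 ≤ θ / c' := div_nonneg hθ.1 hc'.le
  have h1 : |y - y'| ≤ 2 * c' := (abs_sub _ _).trans (by linarith)
  rw [add_sub_add_right_eq_sub, ← mul_sub, abs_mul, abs_of_nonneg h0]
  calc θ / c' * |y - y'| ≤ θ / c' * (2 * c') := by gcongr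
    _ = 2 * θ := by field_simp

theorem encode_eq (n m : ℕ) (hc' : 0 < c') (hθ : θ ∈ Set.Icc (0 : ℝ) (1 / 4)) {y : Fin D → ℝ}
    (hy : ∀ j, |y j| ≤ c') :
    encode n m D c' θ y = Law.toMeasure
      (∏ j, Law.coin (Pi.single j 1 : SecAggGroup n m D) (θ / c' * y j + 1 / 2) ^ m) := by
  have := fun j => show IsProbabilityMeasure (scalarPBM c' m θ (y j)) from
    isProbabilityMeasure_binomial
  rw [← Law.map_sum_pi (fun j => scalarPBM c' m θ (y j))
    (fun j k => k • (Pi.single j 1 : SecAggGroup n m D)) (fun j => .of_discrete)]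
  · rw [encode]
    congr 1
    ext z j
    simp [Finset.sum_apply, Pi.single_apply]
  · intro j
    rw [scalarPBM, Law.map_binomial, projIcc_scalar hc' hθ (hy j)]

instance isProbabilityMeasure_encode (n m : ℕ) (c' θ : ℝ) (y : Fin D → ℝ) :
    IsProbabilityMeasure (encode n m D c' θ y) := by
  have := fun j => show IsProbabilityMeasure (scalarPBM c' m θ (y j)) from
    isProbabilityMeasure_binomial
  exact Measure.isProbabilityMeasure_map Measurable.of_discrete.aemeasurable

instance isProbabilityMeasure_aggregate {d : ℕ} (n m : ℕ) (c K θ : ℝ)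
    (rep : EuclideanSpace ℝ (Fin d) → Fin D → ℝ) (x : Fin n → EuclideanSpace ℝ (Fin d)) :
    IsProbabilityMeasure (aggregate n m c K θ rep x) :=
  Measure.isProbabilityMeasure_map Measurable.of_discrete.aemeasurable

instance isProbabilityMeasure_pbm {d : ℕ} (n m : ℕ) (c K θ : ℝ)
    (u : Fin D → EuclideanSpace ℝ (Fin d))
    (rep : EuclideanSpace ℝ (Fin d) → Fin D → ℝ) (x : Fin n → EuclideanSpace ℝ (Fin d)) :
    IsProbabilityMeasure (pbm n m c K θ u rep x) :=
  Measure.isProbabilityMeasure_map Measurable.of_discrete.aemeasurable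

variable {d : ℕ} {c K : ℝ} {rep : EuclideanSpace ℝ (Fin d) → Fin D → ℝ}

theorem aggregate_eq (hc' : 0 < coeffBound d c K) (hθ : θ ∈ Set.Icc (0 : ℝ) (1 / 4))
    {x : Fin n → EuclideanSpace ℝ (Fin d)} (hy : ∀ i j, |rep (x i) j| ≤ coeffBound d c K) :
    aggregate n m c K θ rep x = Law.toMeasure
      (∏ i, ∏ j, Law.coin (Pi.single j 1 : SecAggGroup n m D)
        (θ / coeffBound d c K * rep (x i) j + 1 / 2) ^ m) :=
  Law.map_sum_pi _ (fun _ => id) (fun _ => measurable_id) _ fun i => by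
    rw [Measure.map_id, encode_eq n m hc' hθ (hy i)]

/-- The double product is regrouped by coordinate. Within a coordinate it is the `m`-th power of a
product of one coin per client, so the single-coin bound is paid `D * m` times. -/
theorem holderDom_aggregate {α : ℝ} (hα : 1 < α) (hc' : 0 < coeffBound d c K)
    (hθ : θ ∈ Set.Icc (0 : ℝ) (1 / 4)) {x x' : Fin n → EuclideanSpace ℝ (Fin d)}
    (hy : ∀ i j, |rep (x i) j| ≤ coeffBound d c K)
    (hy' : ∀ i j, |rep (x' i) j| ≤ coeffBound d c K) (h : Neighboring x x') :
    HolderDom α (D * (m * (9216 * α * θ ^ 2 / n))) (aggregate n m c K θ rep x)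
      (aggregate n m c K θ rep x') := by
  obtain ⟨i₀, hi₀⟩ := h
  rw [aggregate_eq hc' hθ hy, aggregate_eq hc' hθ hy', Finset.prod_comm,
    Finset.prod_comm (s := Finset.univ (α := Fin n))]
  simp_rw [Finset.prod_pow]
  convert Law.holderDom_prod hα (Finset.univ (α := Fin D))
    (ε := m * (9216 * α * θ ^ 2 / n)) fun j _ => Law.holderDom_pow hα m
      (Law.holderDom_prod_coin (Pi.single j 1 : SecAggGroup n m D) hα i₀
        (p := fun i => θ / coeffBound d c K * rep (x i) j + 1 / 2)
        (p' := fun i => θ / coeffBound d c K * rep (x' i) j + 1 / 2) (θ := θ)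
        (fun i => prob_mem hc' hθ (hy i j)) (fun i => prob_mem hc' hθ (hy' i j))
        (abs_prob_sub_le hc' hθ (hy i₀ j) (hy' i₀ j)) fun i hi => by simp only [hi₀ i hi]) using 2 <;>
    simp [Finset.prod_pow]

/-- The parameters of all coins that contribute to coordinate `j` of the sum. -/
def params (n m : ℕ) (c' θ : ℝ) (y : Fin n → ℝ) : List ℝ :=
  (List.finRange n).flatMap fun i => List.replicate m (θ / c' * y i + 1 / 2)

theorem length_params (y : Fin n → ℝ) : (params n m c' θ y).length = n * m := by
  simp [params, List.length_flatMap]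

theorem sum_map_params (y : Fin n → ℝ) (f : ℝ → ℝ) :
    ((params n m c' θ y).map f).sum = ∑ i, m * f (θ / c' * y i + 1 / 2) := by
  rw [params, List.map_flatMap, List.flatMap_def, List.sum_flatten, List.map_map, Fin.sum_univ_def]
  simp [Function.comp_def]

theorem params_mem {y : Fin n → ℝ} (hc' : 0 < c') (hθ : θ ∈ Set.Icc (0 : ℝ) (1 / 4))
    (hy : ∀ i, |y i| ≤ c') : ∀ p ∈ params n m c' θ y, p ∈ Set.Icc (0 : ℝ) 1 := by
  intro p hp
  obtain ⟨i, -, hi⟩ := List.mem_flatMap.1 hp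
  rw [List.eq_of_mem_replicate hi]
  have := prob_mem hc' hθ (hy i)
  exact ⟨by linarith [this.1], by linarith [this.2]⟩

theorem coins_params (y : Fin n → ℝ) :
    Law.coins (params n m c' θ y) = ∏ i, Law.coin 1 (θ / c' * y i + 1 / 2) ^ m := by
  rw [Law.coins, params, List.map_flatMap, List.flatMap_def, List.prod_flatten, List.map_map,
    Fin.prod_univ_def]
  simp [Function.comp_def]

/-- Evaluation at `j` sends the coins of the other coordinates to multiples of `0`, which are the
unit of the convolution algebra. -/
theorem map_eval_aggregate (hc' : 0 < coeffBound d c K) (hθ : θ ∈ Set.Icc (0 : ℝ) (1 / 4))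
    {x : Fin n → EuclideanSpace ℝ (Fin d)} (hy : ∀ i j, |rep (x i) j| ≤ coeffBound d c K)
    (j : Fin D) :
    (aggregate n m c K θ rep x).map (fun s => s j) =
      (Law.toMeasure (Law.coins (params n m (coeffBound d c K) θ fun i => rep (x i) j))).map
        (Nat.cast : ℕ → ZMod (n * m + 1)) := by
  have h1 := Law.toMeasure_map (Pi.evalAddMonoidHom (fun _ : Fin D => ZMod (n * m + 1)) j)
    .of_discrete (∏ i, ∏ j, Law.coin (Pi.single j 1 : SecAggGroup n m D)
        (θ / coeffBound d c K * rep (x i) j + 1 / 2) ^ m)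
  have h2 := Law.toMeasure_map (Nat.castAddMonoidHom (ZMod (n * m + 1))) .of_discrete
    (Law.coins (params n m (coeffBound d c K) θ fun i => rep (x i) j))
  rw [← aggregate_eq hc' hθ hy] at h1
  refine (h1.symm.trans ?_).trans h2
  congr 1
  rw [coins_params, map_prod, map_prod]
  refine Finset.prod_congr rfl fun i _ => ?_
  rw [map_prod, Finset.prod_eq_single j, map_pow, map_pow, Law.map_coin, Law.map_coin]
  · simp
  · intro j' _ hj'
    have := prob_mem hc' hθ (hy i j')
    rw [map_pow, Law.map_coin, Pi.evalAddMonoidHom_apply, Pi.single_eq_of_ne hj'.symm,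
      Law.coin_zero ⟨by linarith [this.1], by linarith [this.2]⟩, one_pow]
  · simp

/-- At most `n * m` heads occur, which is less than the modulus, so reading the residue recovers the
count. -/
theorem integral_val_aggregate (hc' : 0 < coeffBound d c K) (hθ : θ ∈ Set.Icc (0 : ℝ) (1 / 4))
    {x : Fin n → EuclideanSpace ℝ (Fin d)} (hy : ∀ i j, |rep (x i) j| ≤ coeffBound d c K)
    (j : Fin D) (f : ℕ → ℝ) :
    ∫ s, f (s j).val ∂(aggregate n m c K θ rep x) =
      coinExp (params n m (coeffBound d c K) θ fun i => rep (x i) j) f 0 := by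
  have h := integral_map (μ := aggregate n m c K θ rep x) (φ := fun s => s j)
    Measurable.of_discrete.aemeasurable (f := fun z : ZMod (n * m + 1) => f z.val)
    Measurable.of_discrete.aestronglyMeasurable
  rw [← h, map_eval_aggregate hc' hθ hy, integral_map Measurable.of_discrete.aemeasurable
    Measurable.of_discrete.aestronglyMeasurable]
  have := Law.integral_coins (params_mem (m := m) hc' hθ fun i => hy i j)
    (fun k => f (k : ZMod (n * m + 1)).val) 0
  simp only [zero_add] at this
  rw [this]
  refine coinExp_congr fun s hs => ?_
  rw [length_params, zero_add] at hs
  rw [ZMod.val_natCast, Nat.mod_eq_of_lt (by omega)]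

theorem coinExp_params_id (y : Fin n → ℝ) :
    coinExp (params n m c' θ y) (fun s => (s : ℝ)) 0 = m * n / 2 + m * θ / c' * ∑ i, y i := by
  have := sum_map_params (n := n) (m := m) (c' := c') (θ := θ) y id
  rw [List.map_id] at this
  rw [coinExp_id, this]
  simp only [id, Nat.cast_zero, zero_add, mul_add, Finset.sum_add_distrib, Finset.mul_sum,
    Finset.sum_const, Finset.card_univ, Fintype.card_fin, nsmul_eq_mul]
  rw [add_comm]
  congr 1
  · ring
  · refine Finset.sum_congr rfl fun i _ => by ring

theorem coinExp_params_sq_le (y : Fin n → ℝ) :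
    coinExp (params n m c' θ y) (fun s => ((s : ℝ) - (m * n / 2 + m * θ / c' * ∑ i, y i)) ^ 2) 0 ≤
      n * m / 4 := by
  have h1 := coinExp_params_id (m := m) (θ := θ) (c' := c') y
  rw [coinExp_id] at h1
  rw [coinExp_sq, h1, sub_self, sum_map_params]
  calc (0 : ℝ) ^ 2 + ∑ i, m * ((θ / c' * y i + 1 / 2) * (1 - (θ / c' * y i + 1 / 2)))
      ≤ ∑ _i : Fin n, (m : ℝ) * (1 / 4) := by
        rw [zero_pow two_ne_zero, zero_add]
        gcongr with i
        nlinarith [sq_nonneg (θ / c' * y i)]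
    _ = n * m / 4 := by simp; ring

theorem integrable_aggregate {E : Type*} [NormedAddCommGroup E]
    (x : Fin n → EuclideanSpace ℝ (Fin d)) (f : SecAggGroup n m D → E) :
    Integrable f (aggregate n m c K θ rep x) :=
  Integrable.of_finite

variable {u : Fin D → EuclideanSpace ℝ (Fin d)}

theorem mean_eq {x : Fin n → EuclideanSpace ℝ (Fin d)}
    (hx : ∀ i, x i = ∑ j, rep (x i) j • u j) :
    mean x = ∑ j, ((n : ℝ)⁻¹ * ∑ i, rep (x i) j) • u j := by
  rw [mean, Finset.sum_congr rfl fun i _ => hx i, Finset.sum_comm, Finset.smul_sum]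
  refine Finset.sum_congr rfl fun j _ => ?_
  rw [← Finset.sum_smul, smul_smul]

theorem integral_pbm (hc' : 0 < coeffBound d c K) (hθ : θ ∈ Set.Icc (0 : ℝ) (1 / 4))
    (hθ0 : 0 < θ) (hn : 0 < n) (hm : 0 < m) {x : Fin n → EuclideanSpace ℝ (Fin d)}
    (hy : ∀ i j, |rep (x i) j| ≤ coeffBound d c K) (hx : ∀ i, x i = ∑ j, rep (x i) j • u j) :
    ∫ v, v ∂(pbm n m c K θ u rep x) = mean x := by
  have hn' : (0 : ℝ) < n := by exact_mod_cast hn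
  have hm' : (0 : ℝ) < m := by exact_mod_cast hm
  rw [pbm, integral_map (f := fun v => v) Measurable.of_discrete.aemeasurable
    aestronglyMeasurable_id, mean_eq hx]
  simp only [decode]
  rw [integral_finsetSum _ fun j _ => integrable_aggregate x _]
  refine Finset.sum_congr rfl fun j _ => ?_
  rw [integral_smul_const, integral_const_mul,
    integral_sub (integrable_aggregate x _) (integrable_aggregate x _), integral_const,
    integral_val_aggregate hc' hθ hy j (fun k => (k : ℝ)), coinExp_params_id]
  congr 1
  simp only [probReal_univ, one_smul]
  field_simp
  ring

theorem integral_norm_sq_pbm_le (hu : IsTightFrame u) (hc' : 0 < coeffBound d c K)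
    (hθ : θ ∈ Set.Icc (0 : ℝ) (1 / 4)) (hθ0 : 0 < θ) (hn : 0 < n) (hm : 0 < m)
    {x : Fin n → EuclideanSpace ℝ (Fin d)} (hy : ∀ i j, |rep (x i) j| ≤ coeffBound d c K)
    (hx : ∀ i, x i = ∑ j, rep (x i) j • u j) :
    ∫ v, ‖v - mean x‖ ^ 2 ∂(pbm n m c K θ u rep x) ≤
      D * coeffBound d c K ^ 2 / (4 * (n * m * θ ^ 2)) := by
  have hn' : (0 : ℝ) < n := by exact_mod_cast hn
  have hm' : (0 : ℝ) < m := by exact_mod_cast hm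
  set c' := coeffBound d c K with hc'def
  set μ : Fin D → ℝ := fun j => m * n / 2 + m * θ / c' * ∑ i, rep (x i) j with hμ
  have hdiff : ∀ s : SecAggGroup n m D, decode n m c K θ u s - mean x =
      ∑ j, (c' / (m * n * θ) * ((s j).val - μ j)) • u j := by
    intro s
    rw [decode, mean_eq hx, ← Finset.sum_sub_distrib]
    refine Finset.sum_congr rfl fun j _ => ?_
    rw [← sub_smul]
    congr 1
    simp only [hμ, ← hc'def]
    field_simp
    ring
  rw [pbm, integral_map Measurable.of_discrete.aemeasurable
    (by fun_prop : Continuous fun v : EuclideanSpace ℝ (Fin d) =>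
      ‖v - mean x‖ ^ 2).aestronglyMeasurable]
  calc ∫ s, ‖decode n m c K θ u s - mean x‖ ^ 2 ∂(aggregate n m c K θ rep x)
      ≤ ∫ s, ∑ j, (c' / (m * n * θ) * ((s j).val - μ j)) ^ 2 ∂(aggregate n m c K θ rep x) := by
        refine integral_mono (integrable_aggregate x _) (integrable_aggregate x _) fun s => ?_
        simp only [hdiff]
        exact hu.norm_sum_sq_le _
    _ = ∑ j, (c' / (m * n * θ)) ^ 2 *
          ∫ s, (((s j).val : ℝ) - μ j) ^ 2 ∂(aggregate n m c K θ rep x) := by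
        rw [integral_finsetSum _ fun j _ => integrable_aggregate x _]
        refine Finset.sum_congr rfl fun j _ => ?_
        simp_rw [mul_pow]
        rw [integral_const_mul]
    _ ≤ ∑ _j : Fin D, (c' / (m * n * θ)) ^ 2 * (n * m / 4) := by
        gcongr with j
        rw [integral_val_aggregate hc' hθ hy j (fun k => ((k : ℝ) - μ j) ^ 2)]
        exact coinExp_params_sq_le _
    _ = D * c' ^ 2 / (4 * (n * m * θ ^ 2)) := by
        simp only [Finset.sum_const, Finset.card_univ, Fintype.card_fin, nsmul_eq_mul]
        field_simp

theorem clientBits_eq (n m D : ℕ) : clientBits n m D = D * Real.logb 2 (n * m + 1) := by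
  rw [clientBits, SecAggGroup, Nat.card_fun, Nat.card_zmod, Nat.card_fin]
  push_cast
  rw [Real.logb_pow]

/-- These are `nm + 1 ≤ 2nm` and, once `nm ≥ 2`, `nm + 1 ≤ (nm)²`. For `nm = 1` the second fails,
since its right side is `0`. -/
theorem logb_mul_add_one_le (hn : 0 < n) (hm : 0 < m) :
    Real.logb 2 (n * m + 1) ≤ Real.logb 2 m + Real.logb 2 n + 1 ∧
      (1 < n * m → Real.logb 2 (n * m + 1) ≤ 2 * (Real.logb 2 m + Real.logb 2 n)) := by
  have hn' : (1 : ℝ) ≤ n := by exact_mod_cast hn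
  have hm' : (1 : ℝ) ≤ m := by exact_mod_cast hm
  have h1 : (1 : ℝ) ≤ n * m := by nlinarith
  have e : Real.logb 2 m + Real.logb 2 n = Real.logb 2 (n * m) := by
    rw [Real.logb_mul (by positivity) (by positivity), add_comm]
  rw [e]
  refine ⟨?_, fun h => ?_⟩
  · calc Real.logb 2 (n * m + 1) ≤ Real.logb 2 (n * m * 2) :=
          Real.logb_le_logb_of_le (by norm_num) (by positivity) (by linarith)
      _ = _ := by
        rw [Real.logb_mul (by positivity) two_ne_zero, Real.logb_self_eq_one (by norm_num)]
  · have h2 : (2 : ℝ) ≤ n * m := by exact_mod_cast h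
    have : (2 : ℝ) * Real.logb 2 (n * m) = Real.logb 2 ((n * m) ^ 2) := by
      rw [Real.logb_pow]; push_cast; ring
    rw [this]
    exact Real.logb_le_logb_of_le (by norm_num) (by positivity) (by nlinarith)

end Mechanism

/-- Privacy, communication cost and accuracy of the Poisson binomial mechanism. -/
theorem mechanism_properties (K Γ : ℝ) (hK : 0 < K) (hΓ : 0 < Γ) : ∃ C : ℝ, 0 < C ∧
      ∀ (d D : ℕ) (u : Fin D → EuclideanSpace ℝ (Fin d)) (c : ℝ)
        (rep : EuclideanSpace ℝ (Fin d) → Fin D → ℝ) (n m : ℕ) (θ : ℝ),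
        0 < d → (D : ℝ) ≤ Γ * d → IsTightFrame u → 0 < c →
        (∀ x, ‖x‖ ≤ c → IsKashinRep u K x (rep x)) →
        0 < n → 0 < m → θ ∈ Set.Icc (0 : ℝ) (1 / 4) →
        (∀ α ε : ℝ, 1 < α → C * (d * m * θ ^ 2 * α / n) ≤ ε →
          IsRDP (Metric.closedBall 0 c) (aggregate n m c K θ rep) α ε ∧
          IsRDP (Metric.closedBall 0 c) (pbm n m c K θ u rep) α ε) ∧
        (clientBits n m D ≤ C * (d * (Real.logb 2 m + Real.logb 2 n + 1)) ∧
          (1 < n * m → clientBits n m D ≤ C * (d * (Real.logb 2 m + Real.logb 2 n)))) ∧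
        (0 < θ → ∀ x : Fin n → EuclideanSpace ℝ (Fin d), (∀ i, ‖x i‖ ≤ c) →
          Integrable (fun v => v) (pbm n m c K θ u rep x) ∧
          ∫ v, v ∂(pbm n m c K θ u rep x) = mean x ∧
          Integrable (fun v => ‖v - mean x‖ ^ 2) (pbm n m c K θ u rep x) ∧
          ∫ v, ‖v - mean x‖ ^ 2 ∂(pbm n m c K θ u rep x) ≤ C * (c ^ 2 / (n * m * θ ^ 2))) := by
  -- Privacy uses `9216 * Γ`, communication at most `2 * Γ`, and accuracy `K ^ 2 * Γ / 4`.
  refine ⟨9216 * Γ + K ^ 2 * Γ, by positivity, ?_⟩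
  intro d D u c rep n m θ hd hD hu hc hrep hn hm hθ
  have hd' : (0 : ℝ) < d := by exact_mod_cast hd
  have hn' : (0 : ℝ) < n := by exact_mod_cast hn
  have hm' : (0 : ℝ) < m := by exact_mod_cast hm
  have hc' : 0 < coeffBound d c K := by
    have := Real.sqrt_pos.2 hd'
    rw [coeffBound]; positivity
  have hbound : ∀ x : Fin n → EuclideanSpace ℝ (Fin d), (∀ i, ‖x i‖ ≤ c) →
      ∀ i j, |rep (x i) j| ≤ coeffBound d c K := fun x hx i j =>
    abs_rep_le hK hd hu (hx i) (hrep _ (hx i)) j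
  have hKΓ : 0 ≤ K ^ 2 * Γ := by positivity
  refine ⟨fun α ε hα hε => ?_, ⟨?_, fun h => ?_⟩, fun hθ0 x hx => ⟨?_, ?_, ?_, ?_⟩⟩
  · have hε' : D * (m * (9216 * α * θ ^ 2 / n)) ≤ ε := by
      refine le_trans ?_ hε
      have hα0 : 0 < α := by linarith
      calc D * (m * (9216 * α * θ ^ 2 / n)) ≤ (Γ * d) * (m * (9216 * α * θ ^ 2 / n)) := by gcongr
        _ = 9216 * Γ * (d * m * θ ^ 2 * α / n) := by ring
        _ ≤ _ := by gcongr; linarith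
    have key : ∀ x x' : Fin n → EuclideanSpace ℝ (Fin d), (∀ i, x i ∈ Metric.closedBall 0 c) →
        (∀ i, x' i ∈ Metric.closedBall 0 c) → Neighboring x x' →
        HolderDom α ε (aggregate n m c K θ rep x) (aggregate n m c K θ rep x') := by
      intro x x' hx hx' h
      exact (holderDom_aggregate hα hc' hθ (hbound x fun i => by simpa using hx i)
        (hbound x' fun i => by simpa using hx' i) h).mono hα hε'
    -- The output is a function of the sum, so its bound follows by post-processing.
    exact ⟨fun x x' hx hx' h => (key x x' hx hx' h).renyiDiv_le hα,
      fun x x' hx hx' h => ((key x x' hx hx' h).map .of_discrete).renyiDiv_le hα⟩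
  · have h0 : 0 ≤ Real.logb 2 (n * m + 1) := Real.logb_nonneg (by norm_num) (by nlinarith)
    have hle := (logb_mul_add_one_le hn hm).1
    rw [clientBits_eq]
    calc D * Real.logb 2 (n * m + 1) ≤ (Γ * d) * (Real.logb 2 m + Real.logb 2 n + 1) := by gcongr
      _ = Γ * (d * (Real.logb 2 m + Real.logb 2 n + 1)) := by ring
      _ ≤ _ := by
        have := h0.trans hle
        gcongr
        linarith
  · have h0 : 0 ≤ Real.logb 2 (n * m + 1) := Real.logb_nonneg (by norm_num) (by nlinarith)
    have hle := (logb_mul_add_one_le hn hm).2 h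
    rw [clientBits_eq]
    calc D * Real.logb 2 (n * m + 1) ≤ (Γ * d) * (2 * (Real.logb 2 m + Real.logb 2 n)) := by gcongr
      _ = 2 * Γ * (d * (Real.logb 2 m + Real.logb 2 n)) := by ring
      _ ≤ _ := by
        have : 0 ≤ Real.logb 2 m + Real.logb 2 n := by linarith
        gcongr
        linarith
  · exact (integrable_map_measure aestronglyMeasurable_id
      Measurable.of_discrete.aemeasurable).2 (integrable_aggregate x _)
  · exact integral_pbm hc' hθ hθ0 hn hm (hbound x hx) fun i => (hrep _ (hx i)).1
  · exact (integrable_map_measure (by fun_prop : Continuous fun v : EuclideanSpace ℝ (Fin d) =>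
      ‖v - mean x‖ ^ 2).aestronglyMeasurable
      Measurable.of_discrete.aemeasurable).2 (integrable_aggregate x _)
  · refine (integral_norm_sq_pbm_le hu hc' hθ hθ0 hn hm (hbound x hx)
      fun i => (hrep _ (hx i)).1).trans ?_
    calc D * coeffBound d c K ^ 2 / (4 * (n * m * θ ^ 2))
        ≤ (Γ * d) * coeffBound d c K ^ 2 / (4 * (n * m * θ ^ 2)) := by gcongr
      _ = K ^ 2 * Γ / 4 * (c ^ 2 / (n * m * θ ^ 2)) := by
        rw [coeffBound, div_pow, Real.sq_sqrt hd'.le]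
        field_simp
      _ ≤ _ := by gcongr; linarith

/-! ### From norm comparison to Kashin frames -/

section Duality

variable {d D : ℕ}

/-- The dual characterization of Kashin representations, by separation of a vector from the set of
all vectors with small coefficients. -/
theorem exists_isKashinRep {u : Fin D → EuclideanSpace ℝ (Fin d)} {K : ℝ} (hK : 0 ≤ K)
    (h : ∀ y, ‖y‖ ≤ K / √D * ∑ j, |inner ℝ (u j) y|) (x : EuclideanSpace ℝ (Fin d)) :
    ∃ a, IsKashinRep u K x a := by
  set r := K / √D * ‖x‖ with hr
  have hr0 : 0 ≤ r := by positivity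
  let L : (Fin D → ℝ) →ₗ[ℝ] EuclideanSpace ℝ (Fin d) := Fintype.linearCombination ℝ u
  have hL : ∀ a, L a = ∑ j, a j • u j := fun a => Fintype.linearCombination_apply ℝ u a
  set S := L '' Metric.closedBall 0 r with hS
  have hcont : Continuous L := L.continuous_of_finiteDimensional
  have hcomp : IsCompact S := (isCompact_closedBall _ _).image hcont
  have hconv : Convex ℝ S := (convex_closedBall _ _).linear_image L
  by_cases hx : x ∈ S
  · obtain ⟨a, ha, hax⟩ := hx
    refine ⟨a, by rw [← hL, hax], fun j => ?_⟩
    rw [mem_closedBall_zero_iff] at ha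
    exact (norm_le_pi_norm a j).trans ha
  · exfalso
    obtain ⟨f, s, hf, hs⟩ := geometric_hahn_banach_closed_point hconv hcomp.isClosed hx
    set y := (InnerProductSpace.toDual ℝ (EuclideanSpace ℝ (Fin d))).symm f with hy
    have hfy : ∀ v, f v = inner ℝ y v := fun v => by
      rw [hy, InnerProductSpace.toDual_symm_apply]
    -- The sign vector maximizes the separating functional over the image of the cube, and the
    -- maximum is `r` times the `ℓ¹` norm in the hypothesis.
    let a : Fin D → ℝ := fun j => r * SignType.sign (inner ℝ (u j) y)
    have ha : L a ∈ S := by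
      refine ⟨a, mem_closedBall_zero_iff.2 ((pi_norm_le_iff_of_nonneg hr0).2 fun j => ?_), rfl⟩
      rw [Real.norm_eq_abs, abs_mul, abs_of_nonneg hr0]
      refine mul_le_of_le_one_right hr0 ?_
      rcases SignType.sign (inner ℝ (u j) y : ℝ) with _ | _ | _ <;> simp
    have h1 : f (L a) = r * ∑ j, |inner ℝ (u j) y| := by
      rw [hfy, hL, inner_sum, Finset.mul_sum]
      refine Finset.sum_congr rfl fun j _ => ?_
      rw [inner_smul_right, real_inner_comm, mul_assoc, sign_mul_self]
    have h2 : f x ≤ ‖y‖ * ‖x‖ := by rw [hfy]; exact real_inner_le_norm _ _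
    have h3 : ‖y‖ * ‖x‖ ≤ r * ∑ j, |inner ℝ (u j) y| := by
      calc ‖y‖ * ‖x‖ ≤ (K / √D * ∑ j, |inner ℝ (u j) y|) * ‖x‖ := by
            gcongr; exact h y
        _ = _ := by rw [hr]; ring
    have := hf _ ha
    linarith

/-- A subspace on which the `ℓ¹` norm and the `ℓ²` norm are comparable provides a tight frame with
Kashin representations. -/
theorem exists_isTightFrame_of_linearMap
    (T : EuclideanSpace ℝ (Fin d) →ₗ[ℝ] EuclideanSpace ℝ (Fin D)) {B c K : ℝ} (hc : 0 < c)
    (hK : 0 ≤ K) (hBc : B / c ≤ K / √D)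
    (hB : ∀ y, ‖T y‖ ≤ B * ‖y‖) (h : ∀ y, c * ‖y‖ ≤ ∑ j, |T y j|) :
    ∃ u : Fin D → EuclideanSpace ℝ (Fin d), IsTightFrame u ∧ ∀ x, ∃ a, IsKashinRep u K x a := by
  have hinj : Function.Injective T := by
    refine (injective_iff_map_eq_zero T).2 fun y hy => ?_
    have := h y
    rw [hy] at this
    simp only [PiLp.zero_apply, abs_zero, Finset.sum_const_zero] at this
    exact norm_le_zero_iff.1 (nonpos_of_mul_nonpos_right this hc)
  have hrank : Module.finrank ℝ (LinearMap.range T) = d := by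
    rw [LinearMap.finrank_range_of_inj hinj]; simp
  let b : OrthonormalBasis (Fin d) ℝ (LinearMap.range T) :=
    (stdOrthonormalBasis ℝ _).reindex (finCongr hrank)
  -- In an orthonormal basis of the range, `u j` represents the `j`-th coordinate functional;
  -- Parseval's identity is then the Euclidean norm of the ambient space.
  let u : Fin D → EuclideanSpace ℝ (Fin d) := fun j => WithLp.toLp 2 fun i => (b i).1 j
  have hu : ∀ j y, inner ℝ (u j) y = (b.repr.symm y).1 j := by
    intro j y
    rw [← b.sum_repr_symm y]
    simp [u, PiLp.inner_apply, Finset.sum_apply]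
  have hl2 : ∀ y : EuclideanSpace ℝ (Fin d), ‖(b.repr.symm y).1‖ = ‖y‖ := fun y =>
    b.repr.symm.norm_map y
  refine ⟨u, fun y => ?_, exists_isKashinRep hK fun y => ?_⟩
  · simp_rw [hu, ← hl2 y, EuclideanSpace.norm_sq_eq, Real.norm_eq_abs, sq_abs]
  · obtain ⟨z, hz⟩ := (b.repr.symm y).2
    simp_rw [hu, ← hl2 y, ← hz]
    have hs : 0 ≤ ∑ j, |T z j| := Finset.sum_nonneg fun j _ => abs_nonneg _
    have hz' : ‖z‖ ≤ (∑ j, |T z j|) / c := by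
      rw [le_div_iff₀ hc, mul_comm]; exact h z
    rcases le_or_gt 0 B with hB0 | hB0
    · calc ‖T z‖ ≤ B * ‖z‖ := hB z
        _ ≤ B * ((∑ j, |T z j|) / c) := by gcongr
        _ = B / c * ∑ j, |T z j| := by ring
        _ ≤ _ := by gcongr
    · calc ‖T z‖ ≤ B * ‖z‖ := hB z
        _ ≤ 0 := mul_nonpos_of_nonpos_of_nonneg hB0.le (norm_nonneg _)
        _ ≤ _ := by positivity

end Duality

/-! ### Nets of the unit ball -/

section Net

variable {E : Type*} [NormedAddCommGroup E] [NormedSpace ℝ E] [FiniteDimensional ℝ E]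

/-- The unit ball has a `1/2`-net of at most `5 ^ dim` of its points. -/
theorem exists_half_net : ∃ N : Finset E, N.card ≤ 5 ^ Module.finrank ℝ E ∧
    (∀ y ∈ N, ‖y‖ ≤ 1) ∧ ∀ x : E, ‖x‖ ≤ 1 → ∃ y ∈ N, ‖x - y‖ ≤ 1 / 2 := by
  classical
  -- A `1`-separated set of maximal size in the ball of radius `2`, scaled by `1/2`, is the net: an
  -- uncovered point could be added to it. The bound `5 ^ dim` is the volume bound for separated
  -- sets.
  let P : Finset E → Prop := fun s => (∀ c ∈ s, ‖c‖ ≤ 2) ∧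
    ∀ c ∈ s, ∀ d ∈ s, c ≠ d → 1 ≤ ‖c - d‖
  let A : Set ℕ := {k | ∃ s, P s ∧ s.card = k}
  have hA : ∀ k ∈ A, k ≤ 5 ^ Module.finrank ℝ E := by
    rintro k ⟨s, hs, rfl⟩
    exact Besicovitch.card_le_of_separated s hs.1 hs.2
  have hne : A.Nonempty := ⟨0, ∅, by simp [P], rfl⟩
  obtain ⟨s, hs, hcard⟩ := Nat.sSup_mem hne ⟨_, hA⟩
  have hmax : ∀ t, P t → t.card ≤ s.card := fun t ht => by
    rw [hcard]; exact le_csSup ⟨_, hA⟩ ⟨t, ht, rfl⟩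
  refine ⟨s.image fun y => (1 / 2 : ℝ) • y, Finset.card_image_le.trans (hA _ ⟨s, hs, rfl⟩), ?_, ?_⟩
  · intro y hy
    obtain ⟨z, hz, rfl⟩ := Finset.mem_image.1 hy
    have := hs.1 z hz
    rw [norm_smul, Real.norm_of_nonneg (by norm_num)]
    linarith
  · intro x hx
    by_contra! hcon
    have hfar : ∀ z ∈ s, 1 < ‖(2 : ℝ) • x - z‖ := by
      intro z hz
      have := hcon _ (Finset.mem_image_of_mem _ hz)
      have e : (2 : ℝ) • x - z = (2 : ℝ) • (x - (1 / 2 : ℝ) • z) := by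
        rw [smul_sub, smul_smul]; norm_num
      rw [e, norm_smul, Real.norm_of_nonneg (by norm_num)]
      linarith
    have hnot : (2 : ℝ) • x ∉ s := fun hmem => by
      have := hfar _ hmem
      simp at this
      linarith
    have := hmax (insert ((2 : ℝ) • x) s) ⟨?_, ?_⟩
    · rw [Finset.card_insert_of_notMem hnot] at this
      omega
    · intro c hc
      rcases Finset.mem_insert.1 hc with rfl | hc
      · rw [norm_smul, Real.norm_of_nonneg (by norm_num)]; linarith
      · exact hs.1 c hc
    · intro c hc e he hce
      rcases Finset.mem_insert.1 hc with rfl | hc <;> rcases Finset.mem_insert.1 he with rfl | he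
      · exact absurd rfl hce
      · exact (hfar e he).le
      · rw [norm_sub_rev]; exact (hfar c hc).le
      · exact hs.2 c hc e he hce

/-- A net of the unit ball at the scale `2⁻ᵏ`. -/
theorem exists_net (k : ℕ) : ∃ N : Finset E, N.card ≤ 5 ^ (Module.finrank ℝ E * k) ∧
    ∀ x : E, ‖x‖ ≤ 1 → ∃ y ∈ N, ‖x - y‖ ≤ (1 / 2) ^ k := by
  classical
  induction k with
  | zero => exact ⟨{0}, by simp, fun x hx => ⟨0, by simp, by simpa using hx⟩⟩
  | succ k ih =>
    obtain ⟨N, hN, hNx⟩ := ih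
    obtain ⟨H, hH, -, hHx⟩ := exists_half_net (E := E)
    refine ⟨(N ×ˢ H).image fun z => z.1 + (1 / 2 : ℝ) ^ k • z.2, ?_, fun x hx => ?_⟩
    · refine Finset.card_image_le.trans ?_
      rw [Finset.card_product, mul_add, mul_one, pow_add]
      exact Nat.mul_le_mul hN hH
    · obtain ⟨y, hy, hxy⟩ := hNx x hx
      have h2 : (0 : ℝ) < 2 ^ k := by positivity
      obtain ⟨w, hw, hyw⟩ := hHx ((2 : ℝ) ^ k • (x - y)) (by
        rw [norm_smul, Real.norm_of_nonneg h2.le]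
        calc (2 : ℝ) ^ k * ‖x - y‖ ≤ 2 ^ k * (1 / 2) ^ k := by gcongr
          _ = 1 := by rw [← mul_pow]; norm_num)
      refine ⟨y + (1 / 2 : ℝ) ^ k • w, Finset.mem_image.2 ⟨(y, w), by simp [hy, hw], rfl⟩, ?_⟩
      have e : x - (y + (1 / 2 : ℝ) ^ k • w) = (1 / 2 : ℝ) ^ k • ((2 : ℝ) ^ k • (x - y) - w) := by
        rw [smul_sub, smul_smul, ← mul_pow]
        norm_num
        abel
      rw [e, norm_smul, Real.norm_of_nonneg (by positivity), pow_succ]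
      gcongr

end Net

/-! ### Moments of random sign sums -/

section Signs

/-- The sign `±1` encoded by a Boolean. -/
def boolSign (b : Bool) : ℝ := if b then 1 else -1

theorem sum_exp_signs_le {ι : Type*} [Fintype ι] [DecidableEq ι] (x : ι → ℝ) :
    ∑ ε : ι → Bool, Real.exp (∑ i, boolSign (ε i) * x i) ≤
      2 ^ Fintype.card ι * Real.exp ((∑ i, x i ^ 2) / 2) := by
  simp_rw [Real.exp_sum]
  have h := Finset.prod_univ_sum (fun _ : ι => (Finset.univ : Finset Bool))
    fun i b => Real.exp (boolSign b * x i)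
  rw [Fintype.piFinset_univ] at h
  rw [← h, Finset.sum_div, Real.exp_sum, ← Finset.card_univ, ← Finset.prod_const,
    ← Finset.prod_mul_distrib]
  refine Finset.prod_le_prod (fun i _ => Finset.sum_nonneg fun b _ => (Real.exp_pos _).le)
    fun i _ => ?_
  have := Real.cosh_le_exp_half_sq (x i)
  rw [Real.cosh_eq] at this
  simp only [Fintype.sum_bool, boolSign, if_true, one_mul, Bool.false_eq_true, if_false, neg_mul]
  linarith

theorem sum_signs_succ {d : ℕ} (F : (Fin (d + 1) → Bool) → ℝ) :
    ∑ ε, F ε = ∑ ε : Fin d → Bool, (F (Fin.cons true ε) + F (Fin.cons false ε)) := by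
  rw [← (Fin.consEquiv fun _ : Fin (d + 1) => Bool).sum_comp, Fintype.sum_prod_type_right]
  simp [Fin.consEquiv]

/-- The sum of the coordinates of `y` with signs. -/
def signSum {d : ℕ} (y : Fin d → ℝ) (ε : Fin d → Bool) : ℝ := ∑ i, boolSign (ε i) * y i

theorem sum_signSum_sq {d : ℕ} (y : Fin d → ℝ) :
    ∑ ε, signSum y ε ^ 2 = 2 ^ d * ∑ i, y i ^ 2 := by
  induction d with
  | zero => simp [signSum]
  | succ d ih =>
    have h := ih fun i => y i.succ
    rw [sum_signs_succ, Fin.sum_univ_succ]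
    have e : ∀ ε : Fin d → Bool, signSum y (Fin.cons true ε) ^ 2 +
        signSum y (Fin.cons false ε) ^ 2 =
          2 * y 0 ^ 2 + 2 * signSum (fun i => y i.succ) ε ^ 2 := fun ε => by
      simp only [signSum, Fin.sum_univ_succ, Fin.cons_zero, Fin.cons_succ, boolSign]
      simp only [if_true, Bool.false_eq_true, if_false]
      ring
    simp_rw [e]
    simp only [Finset.sum_add_distrib, ← Finset.mul_sum, h]
    simp
    ring

theorem sum_signSum_pow_four_le {d : ℕ} (y : Fin d → ℝ) :
    ∑ ε, signSum y ε ^ 4 ≤ 2 ^ d * (3 * (∑ i, y i ^ 2) ^ 2) := by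
  induction d with
  | zero => simp [signSum]
  | succ d ih =>
    have h := ih fun i => y i.succ
    have h2 := sum_signSum_sq fun i => y (Fin.succ i)
    rw [sum_signs_succ, Fin.sum_univ_succ]
    have e : ∀ ε : Fin d → Bool, signSum y (Fin.cons true ε) ^ 4 +
        signSum y (Fin.cons false ε) ^ 4 =
          2 * y 0 ^ 4 + (12 * y 0 ^ 2 * signSum (fun i => y i.succ) ε ^ 2 +
            2 * signSum (fun i => y i.succ) ε ^ 4) := fun ε => by
      simp only [signSum, Fin.sum_univ_succ, Fin.cons_zero, Fin.cons_succ, boolSign]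
      simp only [if_true, Bool.false_eq_true, if_false]
      ring
    simp_rw [e]
    simp only [Finset.sum_add_distrib, ← Finset.mul_sum, h2]
    simp only [Finset.sum_const, Finset.card_univ, Fintype.card_fun, Fintype.card_bool,
      Fintype.card_fin, nsmul_eq_mul, Nat.cast_pow, Nat.cast_ofNat]
    have h4 : 0 ≤ (2 : ℝ) ^ d * y 0 ^ 4 := by positivity
    rw [pow_succ (2 : ℝ) d]
    linarith

theorem exp_neg_half_le {t : ℝ} (ht : 0 ≤ t) :
    Real.exp (-(t / 2)) ≤ 1 - t ^ 2 / 4 + t ^ 4 / 32 := by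
  have h1 : Real.exp (-(t / 2)) ≤ 1 - t / 2 + t ^ 2 / 8 := by
    have h := Real.quadratic_le_exp_of_nonneg (x := t / 2) (by positivity)
    have h0 : 0 < 1 + t / 2 + (t / 2) ^ 2 / 2 := by positivity
    rw [Real.exp_neg]
    calc (Real.exp (t / 2))⁻¹ ≤ (1 + t / 2 + (t / 2) ^ 2 / 2)⁻¹ := by gcongr
      _ ≤ _ := by
        rw [inv_le_iff_one_le_mul₀ h0]
        nlinarith [pow_nonneg ht 4]
  -- The difference of the two sides is `t * (t - 2)² * (t + 4) / 16`.
  have h2 : 3 * t ^ 2 / 4 - t ^ 4 / 16 ≤ t := by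
    nlinarith [mul_nonneg ht (mul_nonneg (sq_nonneg (t - 2)) (by linarith : 0 ≤ t + 4))]
  linarith

/-- The polynomial majorant of the exponential needs only the second moment, which is `1`, and the
fourth, which is at most `3`: `1 - 1/4 + 3/32 = 1 - 5/32`. -/
theorem sum_exp_neg_abs_signSum_le {d : ℕ} {y : Fin d → ℝ} (hy : ∑ i, y i ^ 2 = 1) :
    ∑ ε, Real.exp (-(|signSum y ε| / 2)) ≤ 2 ^ d * Real.exp (-(5 / 32)) := by
  calc ∑ ε, Real.exp (-(|signSum y ε| / 2))
      ≤ ∑ ε, (1 - signSum y ε ^ 2 / 4 + signSum y ε ^ 4 / 32) := by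
        refine Finset.sum_le_sum fun ε _ => ?_
        have := exp_neg_half_le (abs_nonneg (signSum y ε))
        rwa [sq_abs, (by norm_num : Even 4).pow_abs] at this
    _ = 2 ^ d - (∑ ε, signSum y ε ^ 2) / 4 + (∑ ε, signSum y ε ^ 4) / 32 := by
        rw [Finset.sum_add_distrib, Finset.sum_sub_distrib, Finset.sum_div, Finset.sum_div]
        simp
    _ ≤ 2 ^ d * (1 - 5 / 32) := by
        have h4 := sum_signSum_pow_four_le y
        rw [sum_signSum_sq, hy]
        rw [hy] at h4
        linarith
    _ ≤ _ := by
        gcongr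
        linarith [Real.add_one_le_exp (-(5 / 32 : ℝ))]

end Signs

/-! ### Random sign matrices -/

section RandomMatrix

variable {d D : ℕ}

/-- Markov's inequality for the uniform distribution on a finite type. -/
theorem card_filter_mul_exp_le {X : Type*} [Fintype X] (f : X → ℝ) (s : ℝ) :
    ((Finset.univ.filter fun x => s ≤ f x).card : ℝ) * Real.exp s ≤ ∑ x, Real.exp (f x) := by
  calc _ = ∑ _x ∈ Finset.univ.filter (fun x => s ≤ f x), Real.exp s := by
        rw [Finset.sum_const, nsmul_eq_mul]
    _ ≤ ∑ x ∈ Finset.univ.filter (fun x => s ≤ f x), Real.exp (f x) := by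
        refine Finset.sum_le_sum fun x hx => Real.exp_le_exp.2 (Finset.mem_filter.1 hx).2
    _ ≤ _ := Finset.sum_le_sum_of_subset_of_nonneg (Finset.filter_subset _ _)
        fun _ _ _ => (Real.exp_pos _).le

/-- Few sign matrices have a large bilinear form at a given pair of vectors. -/
theorem card_bilin_ge_le {y : Fin d → ℝ} {z : Fin D → ℝ} (hy : ∑ i, y i ^ 2 ≤ 1)
    (hz : ∑ j, z j ^ 2 ≤ 1) :
    ((Finset.univ.filter fun A : Fin D → Fin d → Bool =>
      3 * √D ≤ ∑ j, z j * signSum y (A j)).card : ℝ) ≤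
      2 ^ (d * D) * Real.exp (-(9 / 2 * D)) := by
  have hD : √(D : ℝ) ^ 2 = D := Real.sq_sqrt (by positivity)
  -- The exponent `3 √D` is the optimal one for the threshold `3 √D`: the moment is `exp (9D/2)`,
  -- against `exp (9D)` in Markov's inequality.
  have key : ∑ A : Fin D → Fin d → Bool, Real.exp (3 * √D * ∑ j, z j * signSum y (A j)) ≤
      2 ^ (d * D) * Real.exp (9 / 2 * D) := by
    rw [← (Equiv.curry (Fin D) (Fin d) Bool).sum_comp]
    have h := sum_exp_signs_le fun q : Fin D × Fin d => 3 * √D * (z q.1 * y q.2)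
    simp only [Fintype.card_prod, Fintype.card_fin] at h
    rw [mul_comm D d] at h
    calc _ = ∑ ε : Fin D × Fin d → Bool,
          Real.exp (∑ q, boolSign (ε q) * (3 * √D * (z q.1 * y q.2))) := by
          refine Finset.sum_congr rfl fun ε _ => ?_
          congr 1
          rw [Fintype.sum_prod_type, Finset.mul_sum]
          refine Finset.sum_congr rfl fun j _ => ?_
          rw [signSum, Finset.mul_sum, Finset.mul_sum]
          refine Finset.sum_congr rfl fun i _ => ?_
          simp only [Equiv.curry_apply, Function.curry]
          ring
      _ ≤ _ := h
      _ ≤ _ := by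
          gcongr
          have e : ∑ q : Fin D × Fin d, (3 * √D * (z q.1 * y q.2)) ^ 2 =
              9 * D * ((∑ j, z j ^ 2) * ∑ i, y i ^ 2) := by
            rw [Finset.sum_mul_sum, Fintype.sum_prod_type, Finset.mul_sum]
            refine Finset.sum_congr rfl fun j _ => ?_
            rw [Finset.mul_sum]
            refine Finset.sum_congr rfl fun i _ => ?_
            linear_combination 9 * z j ^ 2 * y i ^ 2 * hD
          rw [e]
          have h1 : (∑ j, z j ^ 2) * ∑ i, y i ^ 2 ≤ 1 :=
            mul_le_one₀ hz (Finset.sum_nonneg fun _ _ => sq_nonneg _) hy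
          have : (0 : ℝ) ≤ D := by positivity
          nlinarith
  have hm := card_filter_mul_exp_le
    (fun A : Fin D → Fin d → Bool => 3 * √D * ∑ j, z j * signSum y (A j)) (9 * D)
  have hsub : (Finset.univ.filter fun A : Fin D → Fin d → Bool =>
      3 * √D ≤ ∑ j, z j * signSum y (A j)) ⊆ Finset.univ.filter fun A : Fin D → Fin d → Bool =>
      9 * (D : ℝ) ≤ 3 * √D * ∑ j, z j * signSum y (A j) := by
    intro A hA
    simp only [Finset.mem_filter, Finset.mem_univ, true_and] at hA ⊢
    nlinarith [Real.sqrt_nonneg (D : ℝ)]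
  have hcard : ((Finset.univ.filter fun A : Fin D → Fin d → Bool =>
      3 * √D ≤ ∑ j, z j * signSum y (A j)).card : ℝ) ≤
      (Finset.univ.filter fun A : Fin D → Fin d → Bool =>
        9 * (D : ℝ) ≤ 3 * √D * ∑ j, z j * signSum y (A j)).card := by
    exact_mod_cast Finset.card_le_card hsub
  have h9 := hm.trans key
  rw [← le_div_iff₀ (Real.exp_pos _)] at h9
  refine hcard.trans (h9.trans_eq ?_)
  rw [mul_div_assoc, ← Real.exp_sub]
  congr 2
  ring

/-- Few sign matrices map a given unit vector to a vector of small `ℓ¹` norm. -/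
theorem card_l1_le_le {y : Fin d → ℝ} (hy : ∑ i, y i ^ 2 = 1) :
    ((Finset.univ.filter fun A : Fin D → Fin d → Bool =>
      ∑ j, |signSum y (A j)| ≤ D / 8).card : ℝ) ≤ 2 ^ (d * D) * Real.exp (-(3 / 32 * D)) := by
  have key : ∑ A : Fin D → Fin d → Bool, Real.exp (∑ j, -(|signSum y (A j)| / 2)) ≤
      2 ^ (d * D) * Real.exp (-(5 / 32 * D)) := by
    have h := Finset.prod_univ_sum (fun _ : Fin D => (Finset.univ : Finset (Fin d → Bool)))
      fun _ ε => Real.exp (-(|signSum y ε| / 2))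
    rw [Fintype.piFinset_univ] at h
    simp_rw [Real.exp_sum]
    rw [← h, Finset.prod_const, Finset.card_univ, Fintype.card_fin]
    calc _ ≤ (2 ^ d * Real.exp (-(5 / 32))) ^ D := by
          gcongr
          exact sum_exp_neg_abs_signSum_le hy
      _ = _ := by
          rw [mul_pow, ← pow_mul, ← Real.exp_nat_mul]
          congr 2
          ring
  have hm := card_filter_mul_exp_le
    (fun A : Fin D → Fin d → Bool => ∑ j, -(|signSum y (A j)| / 2)) (-(D / 16))
  have hset : (Finset.univ.filter fun A : Fin D → Fin d → Bool =>
      ∑ j, |signSum y (A j)| ≤ D / 8) = Finset.univ.filter fun A : Fin D → Fin d → Bool =>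
      -((D : ℝ) / 16) ≤ ∑ j, -(|signSum y (A j)| / 2) := by
    ext A
    simp only [Finset.mem_filter, Finset.mem_univ, true_and, Finset.sum_neg_distrib,
      ← Finset.sum_div]
    constructor <;> intro h <;> linarith
  rw [hset]
  have h9 := hm.trans key
  rw [← le_div_iff₀ (Real.exp_pos _)] at h9
  refine h9.trans_eq ?_
  rw [mul_div_assoc, ← Real.exp_sub]
  congr 2
  ring

end RandomMatrix

section RandomMatrix

variable {d D : ℕ}

/-- The linear map whose matrix has the entries `±1` given by `A`. -/
def signMap (A : Fin D → Fin d → Bool) :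
    EuclideanSpace ℝ (Fin d) →ₗ[ℝ] EuclideanSpace ℝ (Fin D) where
  toFun y := WithLp.toLp 2 fun j => signSum y (A j)
  map_add' x y := by ext j; simp [signSum, mul_add, Finset.sum_add_distrib]
  map_smul' r y := by ext j; simp [signSum, Finset.mul_sum, mul_left_comm]

@[simp]
theorem signMap_apply (A : Fin D → Fin d → Bool) (y : EuclideanSpace ℝ (Fin d)) (j : Fin D) :
    signMap A y j = signSum y (A j) := rfl

theorem sum_abs_le_sqrt_mul_norm (v : EuclideanSpace ℝ (Fin D)) : ∑ j, |v j| ≤ √D * ‖v‖ := by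
  refine Real.le_sqrt_of_sq_le ?_ |>.trans_eq (b := √(D * ‖v‖ ^ 2)) ?_
  · have h := sq_sum_le_card_mul_sum_sq (s := Finset.univ) (f := fun j => |v j|)
    simp only [Finset.card_univ, Fintype.card_fin, sq_abs] at h
    rw [EuclideanSpace.norm_sq_eq]
    simpa using h
  · rw [Real.sqrt_mul (by positivity), Real.sqrt_sq (norm_nonneg _)]

/-- A linear map is bounded in norm by its bilinear form on `1/2`-nets. -/
theorem norm_le_of_nets {E F : Type*} [NormedAddCommGroup E] [InnerProductSpace ℝ E]
    [FiniteDimensional ℝ E] [NormedAddCommGroup F] [InnerProductSpace ℝ F] (T : E →ₗ[ℝ] F)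
    {b : ℝ} {N : Finset E} {M : Finset F}
    (hN : ∀ x : E, ‖x‖ ≤ 1 → ∃ y ∈ N, ‖x - y‖ ≤ 1 / 2)
    (hM : ∀ x : F, ‖x‖ ≤ 1 → ∃ z ∈ M, ‖x - z‖ ≤ 1 / 2)
    (h : ∀ y ∈ N, ∀ z ∈ M, inner ℝ z (T y) ≤ b) (y : E) : ‖T y‖ ≤ 4 * b * ‖y‖ := by
  -- Each of the two nets costs a factor `2`, because an approximation error of `1/2` is absorbed
  -- into the left side.
  have h1 : ∀ y ∈ N, ‖T y‖ ≤ 2 * b := by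
    intro y hy
    rcases eq_or_ne (T y) 0 with h0 | h0
    · obtain ⟨z, hz, -⟩ := hM 0 (by simp)
      have := h y hy z hz
      rw [h0, inner_zero_right] at this
      rw [h0, norm_zero]
      linarith
    have hpos : 0 < ‖T y‖ := norm_pos_iff.2 h0
    obtain ⟨z, hz, hxz⟩ := hM (‖T y‖⁻¹ • T y) (by
      rw [norm_smul, norm_inv, norm_norm, inv_mul_cancel₀ hpos.ne'])
    have h2 : inner ℝ (‖T y‖⁻¹ • T y - z) (T y) ≤ 1 / 2 * ‖T y‖ :=
      (real_inner_le_norm _ _).trans (by gcongr)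
    rw [inner_sub_left, inner_smul_left, real_inner_self_eq_norm_sq] at h2
    have h3 := h y hy z hz
    have h4 : (starRingEnd ℝ) ‖T y‖⁻¹ * ‖T y‖ ^ 2 = ‖T y‖ := by
      rw [conj_trivial]; field_simp
    rw [h4] at h2
    linarith
  obtain ⟨y₀, hy₀, -⟩ := hN 0 (by simp)
  have hb : 0 ≤ 2 * b := (norm_nonneg _).trans (h1 y₀ hy₀)
  let T' : E →L[ℝ] F := LinearMap.toContinuousLinearMap T
  have hT' : ∀ x, T' x = T x := fun x => rfl
  have hop : ‖T'‖ ≤ 2 * b + ‖T'‖ * (1 / 2) := by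
    refine ContinuousLinearMap.opNorm_le_of_unit_norm (by positivity) fun x hx => ?_
    obtain ⟨w, hw, hxw⟩ := hN x hx.le
    calc ‖T' x‖ = ‖T' w + T' (x - w)‖ := by rw [← map_add, add_sub_cancel]
      _ ≤ ‖T' w‖ + ‖T' (x - w)‖ := norm_add_le _ _
      _ ≤ 2 * b + ‖T'‖ * (1 / 2) := by
        gcongr
        · exact h1 w hw
        · exact (T'.le_opNorm _).trans (by gcongr)
  calc ‖T y‖ = ‖T' y‖ := rfl
    _ ≤ ‖T'‖ * ‖y‖ := T'.le_opNorm y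
    _ ≤ _ := by gcongr; linarith

theorem signSum_smul (r : ℝ) (y : EuclideanSpace ℝ (Fin d)) (ε : Fin d → Bool) :
    signSum (r • y) ε = r * signSum y ε := by
  simp [signSum, Finset.mul_sum, mul_left_comm]

theorem card_l1_le_norm_le {y : EuclideanSpace ℝ (Fin d)} (hy : y ≠ 0) :
    ((Finset.univ.filter fun A : Fin D → Fin d → Bool =>
      ∑ j, |signSum y (A j)| ≤ D / 8 * ‖y‖).card : ℝ) ≤
        2 ^ (d * D) * Real.exp (-(3 / 32 * D)) := by
  have hpos : 0 < ‖y‖ := norm_pos_iff.2 hy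
  have hunit : ∑ i, ((‖y‖⁻¹ • y) i) ^ 2 = 1 := by
    have h := EuclideanSpace.norm_sq_eq (‖y‖⁻¹ • y)
    rw [norm_smul, norm_inv, norm_norm, inv_mul_cancel₀ hpos.ne', one_pow] at h
    simp only [Real.norm_eq_abs, sq_abs] at h
    exact h.symm
  have e : ∀ (A : Fin D → Fin d → Bool) j,
      |signSum (‖y‖⁻¹ • y).ofLp (A j)| = |signSum y (A j)| / ‖y‖ := fun A j => by
    rw [WithLp.ofLp_smul, ← WithLp.ofLp_smul, signSum_smul, abs_mul, abs_of_pos (inv_pos.2 hpos)]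
    ring
  convert card_l1_le_le (D := D) hunit using 3
  refine Finset.filter_congr fun A _ => ?_
  simp_rw [e, ← Finset.sum_div]
  rw [div_le_iff₀ hpos]

theorem card_biUnion_le_real {X Y : Type*} [DecidableEq Y] (s : Finset X) (t : X → Finset Y)
    {b : ℝ} (h : ∀ x ∈ s, ((t x).card : ℝ) ≤ b) : ((s.biUnion t).card : ℝ) ≤ s.card * b := by
  calc ((s.biUnion t).card : ℝ) ≤ ∑ x ∈ s, ((t x).card : ℝ) := by
        exact_mod_cast Finset.card_biUnion_le
    _ ≤ ∑ _x ∈ s, b := Finset.sum_le_sum h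
    _ = _ := by rw [Finset.sum_const, nsmul_eq_mul]

theorem five_pow_le_exp (k : ℕ) : (5 : ℝ) ^ k ≤ Real.exp (2 * k) := by
  have h : (5 : ℝ) ≤ Real.exp 2 := by
    have h1 := Real.exp_one_gt_d9
    have h2 : Real.exp 2 = Real.exp 1 * Real.exp 1 := by rw [← Real.exp_add]; norm_num
    rw [h2]
    nlinarith
  calc (5 : ℝ) ^ k ≤ Real.exp 2 ^ k := by gcongr
    _ = _ := by rw [← Real.exp_nat_mul, mul_comm]

theorem exp_lt_half {x : ℝ} (hx : x ≤ -1) : Real.exp x < 1 / 2 := by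
  have h1 := Real.exp_one_gt_d9
  calc Real.exp x ≤ Real.exp (-1) := Real.exp_le_exp.2 hx
    _ < 1 / 2 := by
      rw [Real.exp_neg, inv_lt_comm₀ (Real.exp_pos _) (by norm_num)]
      norm_num
      linarith

/-- There is a matrix of signs with small operator norm and large `ℓ¹` norms on its image. -/
theorem exists_signs (hd : 0 < d) (hD : D = 200 * d)
    (N : Finset (EuclideanSpace ℝ (Fin d))) (M : Finset (EuclideanSpace ℝ (Fin D)))
    (N' : Finset (EuclideanSpace ℝ (Fin d))) (hN : N.card ≤ 5 ^ d) (hM : M.card ≤ 5 ^ D)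
    (hN' : N'.card ≤ 5 ^ (d * 8)) (hN1 : ∀ y ∈ N, ‖y‖ ≤ 1) (hM1 : ∀ z ∈ M, ‖z‖ ≤ 1) :
    ∃ A : Fin D → Fin d → Bool, (∀ y ∈ N, ∀ z ∈ M, inner ℝ z (signMap A y) ≤ 3 * √D) ∧
      ∀ y ∈ N', y ≠ 0 → D / 8 * ‖y‖ ≤ ∑ j, |signMap A y j| := by
  classical
  have hd1 : (1 : ℝ) ≤ d := by exact_mod_cast hd
  have hDd : (D : ℝ) = 200 * d := by rw [hD]; push_cast; ring
  have hsq : ∀ {k : ℕ} (y : EuclideanSpace ℝ (Fin k)), ‖y‖ ≤ 1 → ∑ i, y i ^ 2 ≤ 1 := by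
    intro k y hy
    have h := EuclideanSpace.norm_sq_eq y
    simp only [Real.norm_eq_abs, sq_abs] at h
    rw [← h]
    exact pow_le_one₀ (norm_nonneg _) hy
  let bad₁ := (N ×ˢ M).biUnion fun q => Finset.univ.filter fun A : Fin D → Fin d → Bool =>
    3 * √D ≤ ∑ j, q.2 j * signSum q.1 (A j)
  let bad₂ := (N'.filter (· ≠ 0)).biUnion fun y =>
    Finset.univ.filter fun A : Fin D → Fin d → Bool => ∑ j, |signSum y (A j)| ≤ D / 8 * ‖y‖
  -- The union bound costs `5 ^ (d + D) ≤ exp (2(d + D))`, which is beaten by `exp (-9D/2)`.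
  have h1 : (bad₁.card : ℝ) < 2 ^ (d * D) * (1 / 2) := by
    calc (bad₁.card : ℝ) ≤ (N ×ˢ M).card * (2 ^ (d * D) * Real.exp (-(9 / 2 * D))) := by
          refine card_biUnion_le_real _ _ fun q hq => ?_
          obtain ⟨hq1, hq2⟩ := Finset.mem_product.1 hq
          exact card_bilin_ge_le (hsq _ (hN1 _ hq1)) (hsq _ (hM1 _ hq2))
      _ ≤ 5 ^ (d + D) * (2 ^ (d * D) * Real.exp (-(9 / 2 * D))) := by
          gcongr
          rw [Finset.card_product, pow_add]
          exact_mod_cast Nat.mul_le_mul hN hM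
      _ ≤ Real.exp (2 * (d + D : ℕ)) * (2 ^ (d * D) * Real.exp (-(9 / 2 * D))) := by
          gcongr
          exact five_pow_le_exp _
      _ = 2 ^ (d * D) * Real.exp (2 * (d + D : ℕ) + -(9 / 2 * D)) := by
          rw [Real.exp_add]; ring
      _ < _ := by
          gcongr
          refine exp_lt_half ?_
          push_cast
          rw [hDd]
          linarith
  -- Here `5 ^ (8d) ≤ exp (16d)` must be beaten by `exp (-3D/32)`; with `D = 200 * d` the exponent
  -- is `18.75 * d`.
  have h2 : (bad₂.card : ℝ) < 2 ^ (d * D) * (1 / 2) := by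
    calc (bad₂.card : ℝ) ≤
          (N'.filter (· ≠ 0)).card * (2 ^ (d * D) * Real.exp (-(3 / 32 * D))) :=
          card_biUnion_le_real _ _ fun y hy => card_l1_le_norm_le (Finset.mem_filter.1 hy).2
      _ ≤ 5 ^ (d * 8) * (2 ^ (d * D) * Real.exp (-(3 / 32 * D))) := by
          gcongr
          exact_mod_cast (Finset.card_filter_le _ _).trans hN'
      _ ≤ Real.exp (2 * (d * 8 : ℕ)) * (2 ^ (d * D) * Real.exp (-(3 / 32 * D))) := by
          gcongr
          exact five_pow_le_exp _
      _ = 2 ^ (d * D) * Real.exp (2 * (d * 8 : ℕ) + -(3 / 32 * D)) := by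
          rw [Real.exp_add]; ring
      _ < _ := by
          gcongr
          refine exp_lt_half ?_
          push_cast
          rw [hDd]
          linarith
  have hex : ∃ A, A ∉ bad₁ ∪ bad₂ := by
    by_contra! hall
    have hu : (Finset.univ : Finset (Fin D → Fin d → Bool)).card ≤ (bad₁ ∪ bad₂).card :=
      Finset.card_le_card fun A _ => hall A
    have hu' : ((Finset.univ : Finset (Fin D → Fin d → Bool)).card : ℝ) ≤
        bad₁.card + bad₂.card := by
      exact_mod_cast hu.trans (Finset.card_union_le _ _)
    simp only [Finset.card_univ, Fintype.card_fun, Fintype.card_bool, Fintype.card_fin,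
      Nat.cast_pow, Nat.cast_ofNat, ← pow_mul] at hu'
    linarith
  obtain ⟨A, hA⟩ := hex
  simp only [Finset.mem_union, not_or, bad₁, bad₂, Finset.mem_biUnion, Finset.mem_filter,
    Finset.mem_univ, true_and, not_exists, not_and, not_le] at hA
  refine ⟨A, fun y hy z hz => ?_, fun y hy hy0 => (hA.2 y ⟨hy, hy0⟩).le⟩
  have := hA.1 (y, z) (Finset.mk_mem_product hy hz)
  refine le_of_eq_of_le ?_ this.le
  simp [PiLp.inner_apply, mul_comm]

end RandomMatrix

/-- Tight frames with Kashin representations at a universal level and with universally bounded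
redundancy exist in every dimension. -/
theorem exists_kashin_frames : ∃ K Γ : ℝ, 0 < K ∧ 0 < Γ ∧ ∀ d : ℕ, 0 < d →
    ∃ (D : ℕ) (u : Fin D → EuclideanSpace ℝ (Fin d)), d ≤ D ∧ (D : ℝ) ≤ Γ * d ∧
      IsTightFrame u ∧ ∀ x, ∃ a, IsKashinRep u K x a := by
  -- The level is `192 = 12 * 16`, the ratio of the norm bound `12 √D` to the `ℓ¹` bound `D / 16`,
  -- times `√D`.
  refine ⟨192, 200, by norm_num, by norm_num, fun d hd => ?_⟩
  obtain ⟨D, hD⟩ : ∃ D, D = 200 * d := ⟨_, rfl⟩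
  have hDpos : (0 : ℝ) < D := by
    have : 0 < D := by omega
    exact_mod_cast this
  have hs : 0 < √(D : ℝ) := Real.sqrt_pos.2 hDpos
  have hss : √(D : ℝ) * √D = D := Real.mul_self_sqrt hDpos.le
  obtain ⟨N, hN, hN1, hNx⟩ := exists_half_net (E := EuclideanSpace ℝ (Fin d))
  obtain ⟨M, hM, hM1, hMx⟩ := exists_half_net (E := EuclideanSpace ℝ (Fin D))
  obtain ⟨N', hN', hNx'⟩ := exists_net (E := EuclideanSpace ℝ (Fin d)) 8
  rw [finrank_euclideanSpace_fin] at hN hM hN'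
  obtain ⟨A, hA1, hA2⟩ := exists_signs hd hD N M N' hN hM hN' hN1 hM1
  have hB : ∀ y, ‖signMap A y‖ ≤ 12 * √D * ‖y‖ := fun y =>
    (norm_le_of_nets (signMap A) hNx hMx hA1 y).trans_eq (by ring)
  -- The net scale is `2⁻⁸` so that the error `12D / 256` fits: `(D/8) * (255/256) - 12D/256 ≥
  -- D/16`.
  have hunit : ∀ y : EuclideanSpace ℝ (Fin d), ‖y‖ = 1 → (D : ℝ) / 16 ≤ ∑ j, |signMap A y j| := by
    intro y hy
    obtain ⟨w, hw, hyw⟩ := hNx' y hy.le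
    have hw1 : 255 / 256 ≤ ‖w‖ := by
      have := norm_sub_norm_le y w
      norm_num at hyw
      linarith
    have hw0 : w ≠ 0 := by
      rintro rfl
      norm_num at hw1
    have h1 := hA2 w hw hw0
    have h2 : ∑ j, |signMap A (y - w) j| ≤ 12 * D * (1 / 256) := by
      calc _ ≤ √D * ‖signMap A (y - w)‖ := sum_abs_le_sqrt_mul_norm _
        _ ≤ √D * (12 * √D * ‖y - w‖) := by gcongr; exact hB _
        _ = 12 * D * ‖y - w‖ := by linear_combination 12 * ‖y - w‖ * hss
        _ ≤ _ := by
          norm_num at hyw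
          gcongr
    have h3 : ∑ j, |signMap A w j| ≤ ∑ j, |signMap A y j| + ∑ j, |signMap A (y - w) j| := by
      rw [← Finset.sum_add_distrib]
      refine Finset.sum_le_sum fun j _ => ?_
      rw [map_sub, PiLp.sub_apply]
      have := abs_sub_abs_le_abs_sub (signMap A w j) (signMap A y j)
      rw [abs_sub_comm] at this
      linarith
    have h4 : (D : ℝ) / 8 * (255 / 256) ≤ D / 8 * ‖w‖ := by gcongr
    linarith
  have hl1 : ∀ y, (D : ℝ) / 16 * ‖y‖ ≤ ∑ j, |signMap A y j| := by
    intro y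
    rcases eq_or_ne y 0 with rfl | hy
    · simp
    have hpos : 0 < ‖y‖ := norm_pos_iff.2 hy
    have h := hunit (‖y‖⁻¹ • y) (by
      rw [norm_smul, norm_inv, norm_norm, inv_mul_cancel₀ hpos.ne'])
    simp_rw [map_smul, PiLp.smul_apply, smul_eq_mul, abs_mul, ← Finset.mul_sum,
      abs_of_pos (inv_pos.2 hpos)] at h
    rwa [inv_mul_eq_div, le_div_iff₀ hpos] at h
  obtain ⟨u, hu, hK⟩ := exists_isTightFrame_of_linearMap (signMap A) (c := (D : ℝ) / 16) (K := 192)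
    (by positivity) (by norm_num) (by
      rw [div_le_div_iff₀ (by positivity) hs]
      nlinarith) hB hl1
  refine ⟨D, u, by omega, ?_, hu, hK⟩
  rw [hD]; push_cast; exact le_rfl

end PBM

end

theorem theorem1 :
    -- tight frames with universal parameters exist in every dimension
    (∃ K Γ : ℝ, 0 < K ∧ 0 < Γ ∧ ∀ d : ℕ, 0 < d →
      ∃ (D : ℕ) (u : Fin D → EuclideanSpace ℝ (Fin d)), d ≤ D ∧ (D : ℝ) ≤ Γ * d ∧
        PBM.IsTightFrame u ∧ ∀ x, ∃ a, PBM.IsKashinRep u K x a) ∧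
    -- the mechanism with any such frame
    (∀ K Γ : ℝ, 0 < K → 0 < Γ → ∃ C : ℝ, 0 < C ∧
      ∀ (d D : ℕ) (u : Fin D → EuclideanSpace ℝ (Fin d)) (c : ℝ)
        (rep : EuclideanSpace ℝ (Fin d) → Fin D → ℝ) (n m : ℕ) (θ : ℝ),
        0 < d → (D : ℝ) ≤ Γ * d → PBM.IsTightFrame u → 0 < c →
        (∀ x, ‖x‖ ≤ c → PBM.IsKashinRep u K x (rep x)) →
        0 < n → 0 < m → θ ∈ Set.Icc (0 : ℝ) (1 / 4) →
        -- privacy, of the server's view and of the output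
        (∀ α ε : ℝ, 1 < α → C * (d * m * θ ^ 2 * α / n) ≤ ε →
          PBM.IsRDP (Metric.closedBall 0 c) (PBM.aggregate n m c K θ rep) α ε ∧
          PBM.IsRDP (Metric.closedBall 0 c) (PBM.pbm n m c K θ u rep) α ε) ∧
        -- communication
        (PBM.clientBits n m D ≤ C * (d * (Real.logb 2 m + Real.logb 2 n + 1)) ∧
          (1 < n * m → PBM.clientBits n m D ≤ C * (d * (Real.logb 2 m + Real.logb 2 n)))) ∧
        -- accuracy
        (0 < θ → ∀ x : Fin n → EuclideanSpace ℝ (Fin d), (∀ i, ‖x i‖ ≤ c) →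
          MeasureTheory.Integrable (fun v => v) (PBM.pbm n m c K θ u rep x) ∧
          ∫ v, v ∂(PBM.pbm n m c K θ u rep x) = PBM.mean x ∧
          MeasureTheory.Integrable (fun v => ‖v - PBM.mean x‖ ^ 2)
            (PBM.pbm n m c K θ u rep x) ∧
          ∫ v, ‖v - PBM.mean x‖ ^ 2 ∂(PBM.pbm n m c K θ u rep x) ≤
            C * (c ^ 2 / (n * m * θ ^ 2)))) := by
  exact ⟨PBM.exists_kashin_frames, PBM.mechanism_properties⟩
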